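/- For a positive integer $n$ let $\mathcal C_n=\mathbb Z\times(\mathbb Z/2n\mathbb Z)$ be the even-width cylinder, in which each vertex $(x,y)$ is the source of four directed edges, ending at $(x\pm1,y)$ and $(x,y\pm1)$. Let $p\in(0,1)$. Independently for each vertex of $\mathcal C_n$, a two-sided mirror is placed on it with probability $p$, and no mirror otherwise. In the Lorentz mirror model a mirror is a north-west (NW) mirror or a north-east (NE) mirror with probability $\frac12$ each, independently; in the Manhattan model a mirror at $(x,y)$ is an NW mirror if $x-y$ is even and an NE mirror if $x-y$ is odd. Light travels along the edges; it keeps its direction at a vertex without a mirror, an NW mirror exchanges the directions of travel east $\leftrightarrow$ south and west $\leftrightarrow$ north, and an NE mirror exchanges east $\leftrightarrow$ north and west $\leftrightarrow$ south. A trajectory $L$ is a finite non-empty sequence of directed edges that light crosses in order, and its vertices are all the endpoints of these edges. Let $\mathbb P_p$ be the law of the resulting configuration, and let $B_n^{(M)}$ be the event that every trajectory on $\mathcal C_n$ that contains a vertex of $\{(0,y): y\in\mathbb Z/2n\mathbb Z\}$ has all its vertices in $\{-M,-M+1,\dots,M\}\times(\mathbb Z/2n\mathbb Z)$. **Theorem.**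 For each of the two models and each $p\in(0,1)$ there exists a constant $C_0>0$ such that for all integers $n>C_0$ and $M>C_0n^{10}$, $$\mathbb P_p\bigl(B_n^{(M)}\bigr)\ \ge\ 1-C_0\exp\left(-\frac{M}{C_0\,n^{10}}\right).$$ -/

import Mathlib

open MeasureTheory

noncomputable section

namespace MirrorModel

/-- The state of a vertex: no mirror, a two-sided north-west mirror (joining the north-west
corner to the south-east corner), or a two-sided north-east mirror. -/
inductive Site
  | empty
  | nw
  | ne
  deriving DecidableEq

/-- All sets of states of a vertex are measurable. -/
instance : MeasurableSpace Site := ⊤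

/-- The four directions of travel along the edges; `east` is `(1, 0)`, `north` is `(0, 1)`. -/
inductive Direction
  | east
  | north
  | west
  | south
  deriving DecidableEq

instance : Fintype Direction :=
  ⟨{.east, .north, .west, .south}, fun d => by cases d <;> decide⟩

/-- The direction in which light leaves a vertex, as a function of the state of the vertex and of
the direction in which the light arrives. -/
def Site.deflect : Site → Direction → Direction
  | .empty, d => d
  | .nw, .east => .south
  | .nw, .south => .east
  | .nw, .west => .north
  | .nw, .north => .west
  | .ne, .east => .north
  | .ne, .north => .east
  | .ne, .west => .south
  | .ne, .south => .west

/-- The vertices of the cylinder `ℤ × (ℤ / 2nℤ)`. -/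
abbrev Vertex (n : ℕ) : Type := ℤ × ZMod (2 * n)

/-- The neighbour of a vertex of the cylinder in a given direction. -/
def Vertex.move {n : ℕ} (v : Vertex n) : Direction → Vertex n
  | .east => (v.1 + 1, v.2)
  | .north => (v.1, v.2 + 1)
  | .west => (v.1 - 1, v.2)
  | .south => (v.1, v.2 - 1)

/-- The directed edges of the cylinder, each given by its source and its direction. -/
abbrev Edge (n : ℕ) : Type := Vertex n × Direction

/-- The vertex at which a directed edge starts. -/
def Edge.source {n : ℕ} (e : Edge n) : Vertex n := e.1

/-- The vertex at which a directed edge ends. -/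
def Edge.target {n : ℕ} (e : Edge n) : Vertex n := Vertex.move e.1 e.2

/-- A mirror configuration on the cylinder. -/
abbrev Config (n : ℕ) : Type := Vertex n → Site

/-- The directed edge that light crosses right after it has crossed the directed edge `e`. -/
def Config.next {n : ℕ} (ω : Config n) (e : Edge n) : Edge n :=
  (Edge.target e, (ω (Edge.target e)).deflect e.2)

/-- A trajectory is a nonempty finite sequence of directed edges that light crosses in order. -/
def IsTrajectory {n : ℕ} (ω : Config n) (L : List (Edge n)) : Prop :=
  L ≠ [] ∧ L.IsChain (fun e e' => e' = ω.next e)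

/-- The set `V(L)` of the vertices of a sequence of directed edges. -/
def vertexSet {n : ℕ} (L : List (Edge n)) : Set (Vertex n) :=
  {v | ∃ e ∈ L, v = Edge.source e ∨ v = Edge.target e}

/-- The event that every trajectory containing a vertex of the section `x = 0` is contained in
`{-M, …, M} × (ℤ / 2nℤ)`. -/
def localizationEvent (n M : ℕ) : Set (Config n) :=
  {ω | ∀ L : List (Edge n), IsTrajectory ω L → (∃ v ∈ vertexSet L, v.1 = 0) →
    ∀ v ∈ vertexSet L, -(M : ℤ) ≤ v.1 ∧ v.1 ≤ (M : ℤ)}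

/-- The two models. -/
inductive Model
  | lorentz
  | manhattan

/-- The mirror that the Manhattan model allows at the vertex `(x, y)`: a north-west mirror if
`x - y` is even, a north-east mirror otherwise (the parity of `y` makes sense because the width
of the cylinder is even). -/
def manhattanMirror {n : ℕ} (v : Vertex n) : Site :=
  if Even (v.1 - (v.2.val : ℤ)) then Site.nw else Site.ne

/-- The law of the state of a vertex. With probability `p` there is a mirror; in the Lorentz model
it is a north-west or a north-east mirror with probability `1/2` each, in the Manhattan model it
is the one prescribed at that vertex. -/
def siteLaw {n : ℕ} (p : ℝ) : Model → Vertex n → Measure Site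
  | .lorentz, _ =>
      ENNReal.ofReal (1 - p) • Measure.dirac Site.empty
        + ENNReal.ofReal (p / 2) • Measure.dirac Site.nw
        + ENNReal.ofReal (p / 2) • Measure.dirac Site.ne
  | .manhattan, v =>
      ENNReal.ofReal (1 - p) • Measure.dirac Site.empty
        + ENNReal.ofReal p • Measure.dirac (manhattanMirror v)

theorem isProbabilityMeasure_siteLaw {n : ℕ} {p : ℝ} (h0 : 0 ≤ p) (h1 : p ≤ 1) (m : Model)
    (v : Vertex n) : IsProbabilityMeasure (siteLaw p m v) := by
  have h2 : (0 : ℝ) ≤ 1 - p := by linarith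
  have h3 : (0 : ℝ) ≤ p / 2 := by linarith
  constructor
  cases m
  · simp only [siteLaw, Measure.add_apply, Measure.smul_apply, measure_univ, smul_eq_mul, mul_one]
    rw [← ENNReal.ofReal_add h2 h3, ← ENNReal.ofReal_add (by linarith) h3, ← ENNReal.ofReal_one]
    congr 1
    ring
  · simp only [siteLaw, Measure.add_apply, Measure.smul_apply, measure_univ, smul_eq_mul, mul_one]
    rw [← ENNReal.ofReal_add h2 h0, ← ENNReal.ofReal_one]
    congr 1
    ring

/-- The law `ℙ_p` of the random configuration: the states of different vertices are independent. -/
def configLaw (m : Model) (n : ℕ) (p : ℝ) : Measure (Config n) :=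
  Measure.infinitePi (fun v : Vertex n => siteLaw p m v)

theorem isProbabilityMeasure_configLaw (m : Model) (n : ℕ) {p : ℝ} (h0 : 0 ≤ p) (h1 : p ≤ 1) :
    IsProbabilityMeasure (configLaw m n p) := by
  have : ∀ v : Vertex n, IsProbabilityMeasure (siteLaw p m v) :=
    isProbabilityMeasure_siteLaw h0 h1 m
  unfold configLaw
  infer_instance

theorem measurableSet_isTrajectory {n : ℕ} (L : List (Edge n)) :
    MeasurableSet {ω : Config n | IsTrajectory ω L} := by
  have key : ∀ L : List (Edge n),
      MeasurableSet {ω : Config n | L.IsChain (fun e e' => e' = ω.next e)} := by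
    intro L
    induction L with
    | nil => simp
    | cons a l ih =>
      cases l with
      | nil => simp
      | cons b l =>
        simp only [List.isChain_cons_cons]
        refine MeasurableSet.inter ?_ ih
        have h : Measurable fun ω : Config n => ω (Edge.target a) := measurable_pi_apply _
        exact h (MeasurableSpace.measurableSet_top
          (s := {s : Site | b = (Edge.target a, s.deflect a.2)}))
  exact (MeasurableSet.const _).inter (key L)

theorem measurableSet_localizationEvent (n M : ℕ) : MeasurableSet (localizationEvent n M) := by
  have : Countable (ZMod (2 * n)) := by
    cases n with
    | zero => exact inferInstanceAs (Countable ℤ)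
    | succ k => exact inferInstanceAs (Countable (Fin _))
  unfold localizationEvent
  rw [Set.ofPred_forall]
  exact MeasurableSet.iInter fun L =>
    (measurableSet_isTrajectory L).imp (MeasurableSet.const _)

end MirrorModel

end

/-!
Why light is trapped. Cut the cylinder into consecutive sections and count the heights at which
light that comes from the left crosses all of the first `j` sections (`crossers`). This number only
decreases with `j`, and it starts at most at `2 * n`.

As the circumference is even, crossing paths come in pairs, since the paths that turn back pair up
the heights at which they enter; in the Manhattan model, whose mirrors preserve an orientation of
the edges, the two paths of a pair run in opposite directions
(`exists_pair_of_crossers_nonempty`). If the ends of such a pair are joined to each other in the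
next section, then neither path crosses that section (`notMem_crossers_of_joins`). So, if any two
compatible entries of a section of length `2 * n` are joined with probability at least `q`, the
expected number of crossings drops by `q / 2` per section for as long as some crossing survives
with probability `1 / 2`; after a number of sections of order `n / q`, it is at least as likely as
not that no light crosses.

It remains to bound `q` from below by a multiple of `n ^ (-7)`. If every height crosses a section
of length `2 * n` with probability less than `1 / (4 * n)`, then a single such section is already
crossed by no light with probability at least `1 / 2`. Otherwise some path crosses with probability
at least `1 / (4 * n)`, and this is turned into a connection of two given entries
(`le_measureReal_joins_strip`). The tools for this are

* `splice`: if every path from `e` in an event `E` meets every path from `e'` in an event `E'`, when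
  the two paths are taken in two different configurations, then both paths meet in the same
  configuration with probability at least `ℙ(E) ℙ(E')`, because the second path is independent of
  the first one until it meets it; changing one mirror then joins the two paths;
* the symmetries of the models (`Symm`): suitable translations, reflections and rotations;
* a planar crossing lemma (`exists_eq_of_crossing`): a path that crosses a box from left to right
  meets every path that separates its start from the right side.

Two entries on the left side of a square, symmetric about its horizontal axis, are then joined as
follows. The crossing path leaves the upper half of the square through its right side, its top or
its bottom. If it leaves through the bottom, its mirror image leaves the lower half at the same
place, and both are spliced (`le_measureReal_joins_of_exit_north`). If it leaves through the right
side, its image by a rotation crosses the square from bottom to top and is spliced to the path of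
the upper entry, and the result is spliced to the path of the lower entry
(`le_measureReal_joins_of_exit_east`). If it leaves through the top, the first case applies on the
opposite side of the cylinder, where the same two heights are again symmetric about an axis.

With a block length of order at most `n ^ 9`, the blocks on each side of the column `0` are
independent and each one is crossed by no light with probability at least `1 / 2`, so that light is
trapped between two such blocks, up to an exponentially small probability
(`one_sub_le_localizationEvent`).
-/

noncomputable section

namespace MirrorModel

/-! ### Events determined by finitely many coordinates of a product measure -/

instance : Fintype Site :=
  ⟨{.empty, .nw, .ne}, fun s => by cases s <;> decide⟩

instance : MeasurableSingletonClass Site := ⟨fun _ => trivial⟩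

section Product

variable {V W : Type*}

/-- The event `E` only depends on the states of the vertices in `A`. -/
def Determined (E : Set (V → Site)) (A : Set V) : Prop :=
  ∀ ω ω' : V → Site, (∀ v ∈ A, ω v = ω' v) → ω ∈ E → ω' ∈ E

theorem Determined.mono {E : Set (V → Site)} {A B : Set V} (h : Determined E A) (hAB : A ⊆ B) :
    Determined E B :=
  fun ω ω' hω => h ω ω' fun v hv => hω v (hAB hv)

theorem Determined.exists_preimage {E : Set (V → Site)} {A : Finset V} (h : Determined E A) :
    ∃ S : Set (A → Site), E = (fun ω (v : A) => ω v) ⁻¹' S := by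
  refine ⟨(fun ω (v : A) => ω v) '' E, Set.Subset.antisymm (Set.subset_preimage_image _ _) ?_⟩
  rintro ω ⟨ω', hω', he⟩
  exact h ω' ω (fun v hv => congrFun he ⟨v, hv⟩) hω'

theorem Determined.measurableSet {E : Set (V → Site)} {A : Finset V} (h : Determined E A) :
    MeasurableSet E := by
  obtain ⟨S, rfl⟩ := h.exists_preimage
  exact (measurable_pi_lambda _ fun v => measurable_pi_apply _) (Set.toFinite S).measurableSet

variable (ν : V → Measure Site) [∀ v, IsProbabilityMeasure (ν v)]

theorem measureReal_inter_of_determined {E F : Set (V → Site)} {A B : Finset V}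
    (hE : Determined E A) (hF : Determined F B) (hAB : Disjoint A B) :
    (Measure.infinitePi ν).real (E ∩ F) =
      (Measure.infinitePi ν).real E * (Measure.infinitePi ν).real F := by
  have hi : ProbabilityTheory.iIndepFun (fun v (ω : V → Site) => ω v) (Measure.infinitePi ν) :=
    ProbabilityTheory.iIndepFun_infinitePi (X := fun _ s => s) fun _ => measurable_id
  have h2 := hi.indepFun_finset A B hAB fun v => measurable_pi_apply v
  obtain ⟨S, rfl⟩ := hE.exists_preimage
  obtain ⟨T, rfl⟩ := hF.exists_preimage
  simp only [measureReal_def, ← ENNReal.toReal_mul]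
  rw [h2.measure_inter_preimage_eq_mul _ _ (Set.toFinite S).measurableSet
    (Set.toFinite T).measurableSet]

/-- Pulling configurations back along a map that is injective on a finite set of vertices
preserves the probability of the events determined by this set. -/
theorem measureReal_pullback (ν' : W → Measure Site) [∀ w, IsProbabilityMeasure (ν' w)]
    (ψ : W → V) (τ : Site → Site) {D : Finset W} (hψ : Set.InjOn ψ D)
    (hν : ∀ w, (ν (ψ w)).map τ = ν' w) {E : Set (W → Site)} (hE : Determined E D) :
    (Measure.infinitePi ν).real {ω | (fun w => τ (ω (ψ w))) ∈ E} =
      (Measure.infinitePi ν').real E := by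
  have hτ : Measurable τ := measurable_of_finite τ
  obtain ⟨S, rfl⟩ := hE.exists_preimage
  have hS : MeasurableSet S := (Set.toFinite S).measurableSet
  have hinj : Function.Injective fun w : D => ψ w := fun a b h => Subtype.ext (hψ a.2 b.2 h)
  have h1 := Measure.map_infinitePi_infinitePi_of_inj (P := ν) hinj
  have h2 := Measure.map_infinitePi_infinitePi_of_inj (P := ν')
    (Subtype.val_injective (p := (· ∈ D)))
  have h3 := Measure.infinitePi_map_pi (fun w : D => ν (ψ w)) (f := fun _ => τ) fun _ => hτ
  simp only [hν] at h3
  rw [← h1, ← h2, Measure.map_map (by fun_prop) (by fun_prop)] at h3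
  have h4 := congrArg (fun m => m S) h3
  rw [Measure.map_apply (by fun_prop) hS, Measure.map_apply (by fun_prop) hS] at h4
  rw [measureReal_def, measureReal_def]
  exact congrArg ENNReal.toReal h4

/-- Exploration: suppose that the vertices of `A ω` are examined one after the other, each being
chosen in view of the states of the previous ones. If each outcome `ω ∈ E` of the exploration can
be completed to the event `H` by an event `F` about the other vertices with probability at
least `q`, then `H` has at least `q` times the probability of `E`. -/
theorem mul_measureReal_le_of_exploration {D D' : Finset V} {A : (V → Site) → Finset V}
    (hAD : ∀ ω, A ω ⊆ D) (hA : ∀ ω ω', (∀ v ∈ A ω, ω v = ω' v) → A ω' = A ω)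
    {E H : Set (V → Site)} (hE : ∀ ω ω', (∀ v ∈ A ω, ω v = ω' v) → ω ∈ E → ω' ∈ E)
    (hH : MeasurableSet H) {q : ℝ}
    (h : ∀ ω ∈ E, ∃ F : Set (V → Site), Determined F ((D' : Set V) \ A ω) ∧
      q ≤ (Measure.infinitePi ν).real F ∧ ∀ ω', (∀ v ∈ A ω, ω v = ω' v) → ω' ∈ F → ω' ∈ H) :
    q * (Measure.infinitePi ν).real E ≤ (Measure.infinitePi ν).real H := by
  classical
  set μ := Measure.infinitePi ν
  let κ : (V → Site) → D → Option Site := fun ω v => if (v : V) ∈ A ω then some (ω v) else none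
  have hκA : ∀ ω ω', κ ω' = κ ω → ∀ v ∈ A ω, ω v = ω' v := by
    intro ω ω' hk v hv
    have h1 := congrFun hk ⟨v, hAD ω hv⟩
    simp only [κ, hv, if_true] at h1
    split_ifs at h1
    exact (Option.some.inj h1).symm
  have hκ : ∀ ω ω', (∀ v ∈ A ω, ω v = ω' v) → κ ω' = κ ω := by
    intro ω ω' hω
    funext v
    simp only [κ, hA ω ω' hω]
    split_ifs with hv
    · rw [hω v hv]
    · rfl
  have hκm : ∀ k, MeasurableSet (κ ⁻¹' {k}) := by
    intro k
    have : Determined (κ ⁻¹' {k}) D := by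
      intro ω ω' hω hk
      exact (hκ ω ω' fun v hv => hω v (hAD ω hv)).trans hk
    exact this.measurableSet
  have hEm : MeasurableSet E := by
    have : Determined E D := fun ω ω' hω => hE ω ω' fun v hv => hω v (hAD ω hv)
    exact this.measurableSet
  have hsum : ∀ G : Set (V → Site), MeasurableSet G →
      μ.real G = ∑ k, μ.real (κ ⁻¹' {k} ∩ G) := by
    intro G hG
    have := sum_measureReal_preimage_singleton (μ := μ.restrict G) (f := κ) Finset.univ
      fun k _ => hκm k
    simp only [Finset.coe_univ, Set.preimage_univ, measureReal_restrict_apply MeasurableSet.univ,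
      Set.univ_inter] at this
    rw [← this]
    exact Finset.sum_congr rfl fun k _ => measureReal_restrict_apply (hκm k)
  rw [hsum E hEm, hsum H hH, Finset.mul_sum]
  refine Finset.sum_le_sum fun k _ => ?_
  by_cases hne : (κ ⁻¹' {k} ∩ E).Nonempty
  · obtain ⟨ω, rfl, hω⟩ := hne
    obtain ⟨F, hF, hq, hFH⟩ := h ω hω
    have hC : Determined {ω' | ∀ v ∈ A ω, ω v = ω' v} (A ω : Set V) :=
      fun ω₁ ω₂ h12 h1 v hv => (h1 v hv).trans (h12 v hv)
    have hF' : Determined F ((D' \ A ω : Finset V) : Set V) := by rwa [Finset.coe_sdiff]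
    have hind := measureReal_inter_of_determined ν hC hF' Finset.disjoint_sdiff
    have heq : κ ⁻¹' {κ ω} ∩ E ⊆ {ω' | ∀ v ∈ A ω, ω v = ω' v} := fun ω' h' => hκA ω ω' h'.1
    calc q * μ.real (κ ⁻¹' {κ ω} ∩ E)
        ≤ μ.real F * μ.real {ω' | ∀ v ∈ A ω, ω v = ω' v} :=
          mul_le_mul hq (measureReal_mono heq) measureReal_nonneg measureReal_nonneg
      _ = μ.real ({ω' | ∀ v ∈ A ω, ω v = ω' v} ∩ F) := by rw [mul_comm, hind]
      _ ≤ μ.real (κ ⁻¹' {κ ω} ∩ H) :=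
          measureReal_mono fun ω' h' => ⟨hκ ω ω' h'.1, hFH ω' h'.1 h'.2⟩
  · rw [Set.not_nonempty_iff_eq_empty.mp hne]
    simp

/-- Finite energy: if every configuration of `E` can be turned into a configuration of `F` by
changing the state of one vertex of `D` to a state of probability at least `c`, then the
probability of `F` is not much smaller than that of `E`. -/
theorem mul_measureReal_le_of_update [DecidableEq V] {D : Finset V} {E F : Set (V → Site)}
    (hF : Determined F D) {c : ℝ}
    (h : ∀ ω ∈ E, ∃ v ∈ D, ∃ s, c ≤ (ν v).real {s} ∧ Function.update ω v s ∈ F) :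
    c * (Measure.infinitePi ν).real E ≤ 3 * D.card * (Measure.infinitePi ν).real F := by
  classical
  set μ := Measure.infinitePi ν
  have hone : ∀ v ∈ D, ∀ s, c ≤ (ν v).real {s} →
      c * μ.real {ω | Function.update ω v s ∈ F} ≤ μ.real F := by
    intro v hv s hs
    have h1 : Determined {ω | Function.update ω v s ∈ F} ((D.erase v : Finset V) : Set V) := by
      intro ω ω' hω h'
      refine hF _ _ (fun w hw => ?_) h'
      by_cases hwv : w = v
      · subst hwv; simp
      · simpa [hwv] using hω w (by simp [hwv]; exact hw)
    have h2 : Determined {ω : V → Site | ω v = s} (({v} : Finset V) : Set V) := by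
      intro ω ω' hω h'
      rw [Set.mem_ofPred_eq, ← hω v (by simp)]
      exact h'
    have h3 := measureReal_inter_of_determined ν h1 h2 (by simp)
    have h4 : μ.real {ω : V → Site | ω v = s} = (ν v).real {s} := by
      have := Measure.infinitePi_map_eval ν v
      rw [← this, measureReal_def, measureReal_def,
        Measure.map_apply (measurable_pi_apply v) (measurableSet_singleton s)]
      rfl
    calc c * μ.real {ω | Function.update ω v s ∈ F}
        ≤ (ν v).real {s} * μ.real {ω | Function.update ω v s ∈ F} :=
          mul_le_mul_of_nonneg_right hs measureReal_nonneg
      _ = μ.real ({ω | Function.update ω v s ∈ F} ∩ {ω : V → Site | ω v = s}) := by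
          rw [h3, h4, mul_comm]
      _ ≤ μ.real F := by
          refine measureReal_mono ?_
          rintro ω ⟨ha, hb⟩
          have : Function.update ω v s = ω := by
            rw [← hb]; exact Function.update_eq_self v ω
          rwa [Set.mem_ofPred_eq, this] at ha
  rcases le_or_gt c 0 with hc | hc
  · have h1 : c * μ.real E ≤ 0 := mul_nonpos_of_nonpos_of_nonneg hc measureReal_nonneg
    have h2 : 0 ≤ 3 * (D.card : ℝ) * μ.real F := by positivity
    linarith
  let I : Finset (V × Site) := (D ×ˢ Finset.univ).filter fun x => c ≤ (ν x.1).real {x.2}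
  have hsub : E ⊆ ⋃ x ∈ I, {ω | Function.update ω x.1 x.2 ∈ F} := by
    intro ω hω
    obtain ⟨v, hv, s, hs, hu⟩ := h ω hω
    simp only [Set.mem_iUnion]
    exact ⟨(v, s), by simp [I, hv, hs], hu⟩
  have hcard : (I.card : ℝ) ≤ 3 * D.card := by
    have h1 : I.card ≤ D.card * 3 := by
      refine (Finset.card_filter_le _ _).trans ?_
      rw [Finset.card_product]
      rfl
    have : (I.card : ℝ) ≤ D.card * 3 := by exact_mod_cast h1
    linarith
  calc c * μ.real E ≤ c * ∑ x ∈ I, μ.real {ω | Function.update ω x.1 x.2 ∈ F} :=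
        mul_le_mul_of_nonneg_left
          ((measureReal_mono hsub (measure_ne_top _ _)).trans
            (measureReal_biUnion_finset_le _ _)) hc.le
    _ ≤ ∑ x ∈ I, μ.real F := by
        rw [Finset.mul_sum]
        refine Finset.sum_le_sum fun x hx => ?_
        simp only [I, Finset.mem_filter, Finset.mem_product] at hx
        exact hone x.1 hx.1.1 x.2 hx.2
    _ = I.card * μ.real F := by simp
    _ ≤ 3 * D.card * μ.real F := mul_le_mul_of_nonneg_right hcard measureReal_nonneg

end Product

/-! ### Light paths on `ℤ × R` -/

/-- The opposite direction of travel. -/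
def Direction.opp : Direction → Direction
  | .east => .west
  | .north => .south
  | .west => .east
  | .south => .north

@[simp]
theorem Direction.opp_opp (d : Direction) : d.opp.opp = d := by cases d <;> rfl

theorem Direction.opp_ne (d : Direction) : d.opp ≠ d := by cases d <;> decide

theorem Site.deflect_opp_deflect (s : Site) (d : Direction) :
    s.deflect (s.deflect d).opp = d.opp := by
  cases s <;> cases d <;> rfl

theorem Site.deflect_ne_opp (s : Site) (d : Direction) : s.deflect d ≠ d.opp := by
  cases s <;> cases d <;> decide

/-- Any two different corners of a vertex are joined by light in one of the three states. -/
theorem Site.exists_deflect_eq {d d' : Direction} (h : d ≠ d') :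
    ∃ s : Site, s.deflect d = d'.opp := by
  revert h
  cases d <;> cases d' <;> simp only [ne_eq, not_true_eq_false, IsEmpty.forall_iff, reduceCtorEq,
    not_false_eq_true, forall_const, Direction.opp] <;>
  first
    | exact ⟨.empty, rfl⟩
    | exact ⟨.nw, rfl⟩
    | exact ⟨.ne, rfl⟩

section Paths

variable {R : Type*} [CommRing R]

/-- The neighbour in a given direction, for the plane `R = ℤ` and the cylinders `R = ZMod (2 * n)`
alike. -/
def hop (v : ℤ × R) : Direction → ℤ × R
  | .east => (v.1 + 1, v.2)
  | .north => (v.1, v.2 + 1)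
  | .west => (v.1 - 1, v.2)
  | .south => (v.1, v.2 - 1)

@[simp]
theorem hop_opp (v : ℤ × R) (d : Direction) : hop (hop v d) d.opp = v := by
  cases d <;> simp [hop, Direction.opp]

/-- The end of a directed edge. -/
def tgt (e : (ℤ × R) × Direction) : ℤ × R := hop e.1 e.2

/-- A directed edge, travelled in the other direction. -/
def rev (e : (ℤ × R) × Direction) : (ℤ × R) × Direction := (tgt e, e.2.opp)

@[simp]
theorem tgt_rev (e : (ℤ × R) × Direction) : tgt (rev e) = e.1 := by simp [tgt, rev]

@[simp]
theorem rev_rev (e : (ℤ × R) × Direction) : rev (rev e) = e := by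
  obtain ⟨v, d⟩ := e
  simp [rev, tgt]

theorem rev_injective : Function.Injective (rev (R := R)) :=
  Function.LeftInverse.injective rev_rev

theorem eq_of_tgt_eq {e f : (ℤ × R) × Direction} (h : tgt e = tgt f) (h' : e.2 = f.2) : e = f :=
  rev_injective (Prod.ext h (congrArg Direction.opp h'))

/-- The directed edge that light crosses right after the directed edge `e`. -/
def step (ω : ℤ × R → Site) (e : (ℤ × R) × Direction) : (ℤ × R) × Direction :=
  (tgt e, (ω (tgt e)).deflect e.2)

theorem step_rev_step (ω : ℤ × R → Site) (e : (ℤ × R) × Direction) :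
    step ω (rev (step ω e)) = rev e := by
  have h : tgt (rev (step ω e)) = tgt e := tgt_rev _
  rw [step, h]
  exact Prod.ext rfl (Site.deflect_opp_deflect _ _)

theorem step_injective (ω : ℤ × R → Site) : Function.Injective (step ω) := by
  intro e f h
  apply rev_injective
  rw [← step_rev_step ω e, h, step_rev_step]

/-- Light that crosses `e` crosses `f` later on, and all the vertices at which it is deflected in
between lie in `D`. -/
def Joins (ω : ℤ × R → Site) (D : Set (ℤ × R)) (e f : (ℤ × R) × Direction) : Prop :=
  ∃ k, (step ω)^[k] e = f ∧ ∀ i < k, tgt ((step ω)^[i] e) ∈ D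

theorem Joins.refl (ω : ℤ × R → Site) (D : Set (ℤ × R)) (e : (ℤ × R) × Direction) :
    Joins ω D e e := ⟨0, rfl, by simp⟩

theorem Joins.single {ω : ℤ × R → Site} {D : Set (ℤ × R)} {e : (ℤ × R) × Direction}
    (h : tgt e ∈ D) : Joins ω D e (step ω e) :=
  ⟨1, rfl, fun i hi => by rwa [Nat.lt_one_iff.mp hi]⟩

theorem Joins.trans {ω : ℤ × R → Site} {D : Set (ℤ × R)} {e f g : (ℤ × R) × Direction}
    (h : Joins ω D e f) (h' : Joins ω D f g) : Joins ω D e g := by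
  obtain ⟨k, rfl, hk⟩ := h
  obtain ⟨l, rfl, hl⟩ := h'
  refine ⟨l + k, Function.iterate_add_apply _ _ _ _, fun i hi => ?_⟩
  rcases lt_or_ge i k with h | h
  · exact hk i h
  · have := hl (i - k) (by omega)
    rwa [← Function.iterate_add_apply, Nat.sub_add_cancel h] at this

theorem Joins.mono {ω : ℤ × R → Site} {D D' : Set (ℤ × R)} {e f : (ℤ × R) × Direction}
    (h : Joins ω D e f) (hD : D ⊆ D') : Joins ω D' e f := by
  obtain ⟨k, hk, hi⟩ := h
  exact ⟨k, hk, fun i h => hD (hi i h)⟩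

/-- Light paths can be travelled backwards. -/
theorem Joins.reverse {ω : ℤ × R → Site} {D : Set (ℤ × R)} {e f : (ℤ × R) × Direction}
    (h : Joins ω D e f) : Joins ω D (rev f) (rev e) := by
  obtain ⟨k, rfl, hk⟩ := h
  induction k with
  | zero => exact Joins.refl _ _ _
  | succ k ih =>
    refine Joins.trans ?_ (ih fun i hi => hk i (by omega))
    rw [Function.iterate_succ_apply']
    have h1 := Joins.single (ω := ω) (D := D) (e := rev (step ω ((step ω)^[k] e)))
      (by rw [tgt_rev]; exact hk k (by omega))
    rwa [step_rev_step] at h1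

theorem Joins.eq_or_source_mem {ω : ℤ × R → Site} {D : Set (ℤ × R)} {e f : (ℤ × R) × Direction}
    (h : Joins ω D e f) : f = e ∨ f.1 ∈ D := by
  obtain ⟨k, rfl, hk⟩ := h
  cases k with
  | zero => exact Or.inl rfl
  | succ k =>
    right
    rw [Function.iterate_succ_apply']
    exact hk k (by omega)

theorem Joins.exit_unique {ω : ℤ × R → Site} {D : Set (ℤ × R)} {e f g : (ℤ × R) × Direction}
    (hf : Joins ω D e f) (hg : Joins ω D e g) (hf' : tgt f ∉ D) (hg' : tgt g ∉ D) : f = g := by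
  obtain ⟨k, rfl, hk⟩ := hf
  obtain ⟨l, rfl, hl⟩ := hg
  rcases lt_trichotomy k l with h | h | h
  · exact absurd (hl k h) hf'
  · rw [h]
  · exact absurd (hk l h) hg'

/-- Light does not retrace its path. -/
theorem Joins.ne_rev {ω : ℤ × R → Site} {D : Set (ℤ × R)} {e : (ℤ × R) × Direction} :
    ¬ Joins ω D e (rev e) := by
  rintro ⟨k, hk, -⟩
  -- by reversibility, the path from `e` to `rev e` is symmetric about its middle
  have key : ∀ i ≤ k, (step ω)^[k - i] e = rev ((step ω)^[i] e) := by
    intro i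
    induction i with
    | zero => intro _; simpa using hk
    | succ i ih =>
      intro hi
      apply step_injective ω
      rw [← Function.iterate_succ_apply' (step ω) (k - (i + 1)),
        show (k - (i + 1)).succ = k - i by omega,
        ih (by omega), Function.iterate_succ_apply', step_rev_step]
  rcases Nat.even_or_odd' k with ⟨j, rfl | rfl⟩
  · have h := key j (by omega)
    rw [show 2 * j - j = j by omega] at h
    exact Direction.opp_ne _ (congrArg Prod.snd h).symm
  · have h := key j (by omega)
    rw [show 2 * j + 1 - j = j + 1 by omega, Function.iterate_succ_apply'] at h
    exact Site.deflect_ne_opp _ _ (congrArg Prod.snd h)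

/-- Light that enters a finite set of vertices leaves it again. -/
theorem exists_exit (ω : ℤ × R → Site) {D : Set (ℤ × R)} (hD : D.Finite)
    {e : (ℤ × R) × Direction} (he : e.1 ∉ D) : ∃ f, Joins ω D e f ∧ tgt f ∉ D := by
  by_contra! hcon
  have hall : ∀ k, tgt ((step ω)^[k] e) ∈ D := by
    intro k
    induction k using Nat.strong_induction_on with
    | _ k ih => exact hcon _ ⟨k, rfl, ih⟩
  have hinj : Function.Injective fun k => (step ω)^[k] e := by
    have aux : ∀ i j, i < j → (step ω)^[i] e ≠ (step ω)^[j] e := by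
      intro i j hij h
      obtain ⟨l, rfl⟩ := Nat.exists_eq_add_of_lt hij
      rw [show i + l + 1 = i + (l + 1) by omega, Function.iterate_add_apply] at h
      have h1 := (step_injective ω).iterate i h
      rw [Function.iterate_succ_apply'] at h1
      apply he
      rw [h1]
      exact hall l
    intro i j h
    rcases lt_trichotomy i j with h' | h' | h'
    · exact absurd h (aux i j h')
    · exact h'
    · exact absurd h.symm (aux j i h')
  have hfin : (Set.range fun k => (step ω)^[k] e).Finite := by
    have hdir : (Set.univ : Set Direction).Finite := Set.finite_univ
    refine ((hD.prod hdir).image rev).subset ?_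
    rintro _ ⟨k, rfl⟩
    exact ⟨rev ((step ω)^[k] e), ⟨hall k, trivial⟩, rev_rev _⟩
  exact Set.infinite_range_of_injective hinj hfin

open Classical in
/-- The vertices at which light that comes in through `e` is deflected before it leaves `D`. -/
def visited (ω : ℤ × R → Site) (D : Finset (ℤ × R)) (e : (ℤ × R) × Direction) : Finset (ℤ × R) :=
  D.filter fun v => ∃ k, (∀ i ≤ k, tgt ((step ω)^[i] e) ∈ D) ∧ tgt ((step ω)^[k] e) = v

theorem visited_subset (ω : ℤ × R → Site) (D : Finset (ℤ × R)) (e : (ℤ × R) × Direction) :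
    visited ω D e ⊆ D := by
  classical
  exact Finset.filter_subset _ _

theorem mem_visited {ω : ℤ × R → Site} {D : Finset (ℤ × R)} {e : (ℤ × R) × Direction}
    {v : ℤ × R} : v ∈ visited ω D e ↔
      ∃ k, (∀ i ≤ k, tgt ((step ω)^[i] e) ∈ D) ∧ tgt ((step ω)^[k] e) = v := by
  classical
  rw [visited, Finset.mem_filter, and_iff_right_iff_imp]
  rintro ⟨k, hk, rfl⟩
  exact hk k le_rfl

theorem Joins.tgt_mem_visited {ω : ℤ × R → Site} {D : Finset (ℤ × R)}
    {e f : (ℤ × R) × Direction} (h : Joins ω D e f) (hf : tgt f ∈ D) : tgt f ∈ visited ω D e := by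
  obtain ⟨k, rfl, hk⟩ := h
  rw [mem_visited]
  refine ⟨k, fun i hi => ?_, rfl⟩
  rcases hi.lt_or_eq with h | rfl
  · exact hk i h
  · exact hf

theorem Joins.source_mem_visited {ω : ℤ × R → Site} {D : Finset (ℤ × R)}
    {e f : (ℤ × R) × Direction} (h : Joins ω D e f) (hf : f.1 ∈ D) (he : e.1 ∉ D) :
    f.1 ∈ visited ω D e := by
  obtain ⟨k, rfl, hk⟩ := h
  cases k with
  | zero => exact absurd hf he
  | succ k =>
    rw [mem_visited]
    refine ⟨k, fun i hi => hk i (by omega), ?_⟩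
    rw [Function.iterate_succ_apply']
    rfl

/-- The path up to its exit from `D` only depends on the states of the vertices that it visits. -/
theorem iterate_step_congr {ω ω' : ℤ × R → Site} {D : Finset (ℤ × R)}
    {e : (ℤ × R) × Direction} (h : ∀ v ∈ visited ω D e, ω v = ω' v) (k : ℕ)
    (hk : ∀ i < k, tgt ((step ω)^[i] e) ∈ D) : (step ω')^[k] e = (step ω)^[k] e := by
  induction k with
  | zero => rfl
  | succ k ih =>
    rw [Function.iterate_succ_apply', Function.iterate_succ_apply',
      ih fun i hi => hk i (by omega), step, step,
      h _ (mem_visited.mpr ⟨k, fun i hi => hk i (by omega), rfl⟩)]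

theorem visited_congr {ω ω' : ℤ × R → Site} {D : Finset (ℤ × R)} {e : (ℤ × R) × Direction}
    (h : ∀ v ∈ visited ω D e, ω v = ω' v) : visited ω' D e = visited ω D e := by
  have key : ∀ k, (∀ i < k, tgt ((step ω')^[i] e) ∈ D) →
      (step ω')^[k] e = (step ω)^[k] e := by
    intro k
    induction k using Nat.strong_induction_on with
    | _ k ih =>
      intro hk
      refine iterate_step_congr h k fun i hi => ?_
      rw [← ih i hi fun j hj => hk j (by omega)]
      exact hk i hi
  ext v
  rw [mem_visited, mem_visited]
  constructor
  · rintro ⟨k, hk, rfl⟩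
    have h1 : ∀ i ≤ k, (step ω')^[i] e = (step ω)^[i] e :=
      fun i hi => key i fun j hj => hk j (by omega)
    exact ⟨k, fun i hi => by rw [← h1 i hi]; exact hk i hi, by rw [h1 k le_rfl]⟩
  · rintro ⟨k, hk, rfl⟩
    have h1 : ∀ i ≤ k, (step ω')^[i] e = (step ω)^[i] e :=
      fun i hi => iterate_step_congr h i fun j hj => hk j (by omega)
    exact ⟨k, fun i hi => by rw [h1 i hi]; exact hk i hi, by rw [h1 k le_rfl]⟩

theorem Joins.congr_visited {ω ω' : ℤ × R → Site} {D : Finset (ℤ × R)} {Q : Set (ℤ × R)}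
    {e f : (ℤ × R) × Direction} (hj : Joins ω Q e f) (hQ : Q ⊆ D)
    (h : ∀ v ∈ visited ω D e, ω v = ω' v) : Joins ω' Q e f := by
  obtain ⟨k, rfl, hk⟩ := hj
  have h1 : ∀ i ≤ k, (step ω')^[i] e = (step ω)^[i] e :=
    fun i hi => iterate_step_congr h i fun j hj => hQ (hk j (by omega))
  exact ⟨k, h1 k le_rfl, fun i hi => by rw [h1 i hi.le]; exact hk i hi⟩

theorem Joins.congr {ω ω' : ℤ × R → Site} {D : Set (ℤ × R)}
    {e f : (ℤ × R) × Direction} (hj : Joins ω D e f) (h : ∀ v ∈ D, ω v = ω' v) :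
    Joins ω' D e f := by
  obtain ⟨k, rfl, hk⟩ := hj
  have h1 : ∀ i ≤ k, (step ω')^[i] e = (step ω)^[i] e := by
    intro i
    induction i with
    | zero => intro _; rfl
    | succ i ih =>
      intro hi
      rw [Function.iterate_succ_apply', Function.iterate_succ_apply', ih (by omega), step, step,
        h _ (hk i (by omega))]
  exact ⟨k, h1 k le_rfl, fun i hi => by rw [h1 i hi.le]; exact hk i hi⟩

theorem determined_joins (D : Set (ℤ × R)) (e f : (ℤ × R) × Direction) :
    Determined {ω | Joins ω D e f} D :=
  fun _ _ hω h => h.congr hω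

theorem determined_visited (D : Finset (ℤ × R)) (e e' : (ℤ × R) × Direction)
    (P : Finset (ℤ × R) → Finset (ℤ × R) → Prop) :
    Determined {ω | P (visited ω D e) (visited ω D e')} (D : Set (ℤ × R)) := by
  intro ω ω' hω h
  have h1 := visited_congr (e := e) fun v hv => hω v (visited_subset ω D e hv)
  have h2 := visited_congr (e := e') fun v hv => hω v (visited_subset ω D e' hv)
  rw [Set.mem_ofPred_eq, h1, h2]
  exact h

/-- If the light paths from `e` and from `e'` meet in `D`, then changing the state of their first
common vertex joins them to a path from `e` to the reverse of `e'`. The hypothesis `hturn` provides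
the state, for paths that arrive at this vertex from different sides. -/
theorem exists_update_joins [DecidableEq R] {ω : ℤ × R → Site} {D : Finset (ℤ × R)}
    {e e' : (ℤ × R) × Direction} (he : e.1 ∉ D) (he' : e'.1 ∉ D) (hne : e ≠ e')
    (hmeet : (visited ω D e ∩ visited ω D e').Nonempty) {ok : ℤ × R → Site → Prop}
    (hturn : ∀ i j, tgt ((step ω)^[i] e) = tgt ((step ω)^[j] e') →
      (∀ l ≤ i, tgt ((step ω)^[l] e) ∈ D) → (∀ l ≤ j, tgt ((step ω)^[l] e') ∈ D) →
      ((step ω)^[i] e).2 ≠ ((step ω)^[j] e').2 → ∃ s, ok (tgt ((step ω)^[i] e)) s ∧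
        s.deflect ((step ω)^[i] e).2 = ((step ω)^[j] e').2.opp) :
    ∃ v ∈ D, ∃ s, ok v s ∧ Joins (Function.update ω v s) D e (rev e') := by
  classical
  have hex : ∃ i, (∀ l ≤ i, tgt ((step ω)^[l] e) ∈ D) ∧
      tgt ((step ω)^[i] e) ∈ visited ω D e' := by
    obtain ⟨v, hv⟩ := hmeet
    rw [Finset.mem_inter, mem_visited] at hv
    obtain ⟨⟨k, hk, rfl⟩, h⟩ := hv
    exact ⟨k, hk, h⟩
  obtain ⟨hi, hiv⟩ := Nat.find_spec hex
  have hmin := fun l => Nat.find_min hex (m := l)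
  set i := Nat.find hex
  have hex' : ∃ j, (∀ l ≤ j, tgt ((step ω)^[l] e') ∈ D) ∧
      tgt ((step ω)^[j] e') = tgt ((step ω)^[i] e) := mem_visited.mp hiv
  obtain ⟨hj, hjv⟩ := Nat.find_spec hex'
  have hmin' := fun l => Nat.find_min hex' (m := l)
  set j := Nat.find hex'
  set v := tgt ((step ω)^[i] e) with hv
  -- the two paths do not arrive at `v` through the same edge
  have hd : ((step ω)^[i] e).2 ≠ ((step ω)^[j] e').2 := by
    intro hd
    have hee : (step ω)^[i] e = (step ω)^[j] e' := eq_of_tgt_eq hjv.symm hd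
    clear_value i j
    cases i with
    | zero =>
      cases j with
      | zero => exact hne hee
      | succ j =>
        rw [Function.iterate_succ_apply'] at hee
        apply he
        rw [show e = step ω ((step ω)^[j] e') from hee]
        exact hj j (by omega)
    | succ i =>
      cases j with
      | zero =>
        rw [Function.iterate_succ_apply'] at hee
        apply he'
        rw [show e' = step ω ((step ω)^[i] e) from hee.symm]
        exact hi i (by omega)
      | succ j =>
        rw [Function.iterate_succ_apply', Function.iterate_succ_apply'] at hee
        refine hmin i (by omega) ⟨fun l hl => hi l (by omega), ?_⟩
        rw [step_injective ω hee]
        exact mem_visited.mpr ⟨j, fun l hl => hj l (by omega), rfl⟩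
  obtain ⟨s, hs, hdef⟩ := hturn i j hjv.symm hi hj hd
  refine ⟨v, hi i le_rfl, s, hs, ?_⟩
  set ω' := Function.update ω v s with hω'
  have hoff : ∀ w, w ≠ v → ω' w = ω w := fun w hw => Function.update_of_ne hw _ _
  have hei : ∀ l ≤ i, (step ω')^[l] e = (step ω)^[l] e := by
    intro l
    induction l with
    | zero => intro _; rfl
    | succ l ih =>
      intro hl
      rw [Function.iterate_succ_apply', Function.iterate_succ_apply', ih (by omega), step, step,
        hoff]
      intro h
      exact hmin l (by omega) ⟨fun l' hl' => hi l' (by omega), h ▸ hiv⟩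
  have hej : ∀ l ≤ j, (step ω')^[l] e' = (step ω)^[l] e' := by
    intro l
    induction l with
    | zero => intro _; rfl
    | succ l ih =>
      intro hl
      rw [Function.iterate_succ_apply', Function.iterate_succ_apply', ih (by omega), step, step,
        hoff]
      intro h
      exact hmin' l (by omega) ⟨fun l' hl' => hj l' (by omega), h⟩
  have h1 : Joins ω' D e ((step ω)^[i] e) :=
    ⟨i, hei i le_rfl, fun l hl => by rw [hei l hl.le]; exact hi l hl.le⟩
  have h2 : Joins ω' D e' ((step ω)^[j] e') :=
    ⟨j, hej j le_rfl, fun l hl => by rw [hej l hl.le]; exact hj l hl.le⟩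
  have h3 : step ω' ((step ω)^[i] e) = rev ((step ω)^[j] e') := by
    refine Prod.ext hjv.symm ?_
    change (ω' v).deflect _ = _
    rw [hω', Function.update_self]
    exact hdef
  refine h1.trans (Joins.trans ?_ h2.reverse)
  rw [← h3]
  exact Joins.single (hi i le_rfl)

end Paths

/-! ### The two models on `ℤ × R` -/

/-- A ring of heights whose elements have a parity: `ℤ` for the plane, `ℤ / 2nℤ` for the cylinder
of width `2n`. -/
class RowParity (R : Type*) [CommRing R] where
  /-- The parity of a height. -/
  par : R →+* ZMod 2

instance : RowParity ℤ := ⟨Int.castRingHom (ZMod 2)⟩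

instance (n : ℕ) : RowParity (ZMod (2 * n)) := ⟨ZMod.castHom (dvd_mul_right 2 n) (ZMod 2)⟩

open RowParity

section Models

variable {R : Type*} [CommRing R] [RowParity R]

/-- The mirror that the Manhattan model allows at a vertex of `ℤ × R`. -/
def mirror (v : ℤ × R) : Site := if (v.1 : ZMod 2) + par v.2 = 0 then .nw else .ne

/-- The law of the state of a vertex of `ℤ × R`; see `siteLaw` for the case of the cylinder. -/
def law (p : ℝ) : Model → ℤ × R → Measure Site
  | .lorentz, _ =>
      ENNReal.ofReal (1 - p) • Measure.dirac Site.empty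
        + ENNReal.ofReal (p / 2) • Measure.dirac Site.nw
        + ENNReal.ofReal (p / 2) • Measure.dirac Site.ne
  | .manhattan, v =>
      ENNReal.ofReal (1 - p) • Measure.dirac Site.empty
        + ENNReal.ofReal p • Measure.dirac (mirror v)

theorem manhattanMirror_eq {n : ℕ} (v : Vertex n) : manhattanMirror v = mirror v := by
  have h : ((v.2.val : ℤ) : ZMod 2) = par v.2 := by
    obtain ⟨x, y⟩ := v
    simp only
    rcases Nat.eq_zero_or_pos n with rfl | hn
    · obtain ⟨k, rfl⟩ := ZMod.intCast_surjective y
      have hk : ZMod.val (Int.cast k : ZMod (2 * 0)) = k.natAbs := by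
        change Int.natAbs (Int.cast k : ℤ) = _
        rw [Int.cast_id]
      rw [hk, map_intCast]
      rcases Int.natAbs_eq k with h | h
      · rw [← h]
      · conv_rhs => rw [h]
        rw [Int.cast_neg, ZMod.neg_eq_self_mod_two]
    · have : NeZero (2 * n) := ⟨by omega⟩
      change _ = ZMod.castHom (dvd_mul_right 2 n) (ZMod 2) y
      rw [ZMod.castHom_apply, ZMod.cast_eq_val]
      simp
  have h2 : Even (v.1 - (v.2.val : ℤ)) ↔ (v.1 : ZMod 2) + par v.2 = 0 := by
    rw [← h, ← ZMod.intCast_eq_zero_iff_even, Int.cast_sub, sub_eq_add_neg,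
      ZMod.neg_eq_self_mod_two]
  simp only [manhattanMirror, mirror, h2]

theorem siteLaw_eq {n : ℕ} (p : ℝ) (m : Model) (v : Vertex n) : siteLaw p m v = law p m v := by
  cases m
  · rfl
  · simp only [siteLaw, law, manhattanMirror_eq]

/-- The states of positive probability. -/
def Allowed (m : Model) (v : ℤ × R) (s : Site) : Prop :=
  m = .manhattan → s = .empty ∨ s = mirror v

/-- The orientation of a directed edge in the Manhattan model: `orient e = 0` for the directed edges
of the Manhattan lattice, whose rows of even height run east and whose columns of odd abscissa run
north, and `orient e = 1` for their reverses. Light never passes from one class to the other. -/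
def orient (e : (ℤ × R) × Direction) : ZMod 2 :=
  match e.2 with
  | .east => par e.1.2
  | .north => e.1.1 + 1
  | .west => par e.1.2 + 1
  | .south => e.1.1

theorem orient_rev (e : (ℤ × R) × Direction) : orient (rev e) = orient e + 1 := by
  obtain ⟨v, d⟩ := e
  have h2 : (1 : ZMod 2) + 1 = 0 := by decide
  cases d <;> simp [orient, rev, tgt, hop, Direction.opp, add_assoc, h2]

/-- The orientation in terms of the end of an edge. -/
theorem orient_eq_tgt (v : ℤ × R) (d : Direction) : orient (hop v d, d) = orient (v, d) := by
  cases d <;> simp [orient, hop]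

theorem orient_step {ω : ℤ × R → Site} {e : (ℤ × R) × Direction}
    (h : Allowed .manhattan (tgt e) (ω (tgt e))) : orient (step ω e) = orient e := by
  obtain ⟨u, d⟩ := e
  rw [← orient_eq_tgt u d]
  simp only [step, tgt] at h ⊢
  set v := hop u d
  have h' := h rfl
  rcases h' with h' | h' <;> rw [h']
  · rfl
  · unfold mirror orient
    generalize (v.1 : ZMod 2) = a
    generalize par v.2 = b
    cases d <;> simp only <;> revert a b <;> decide

theorem orient_iterate {ω : ℤ × R → Site} (h : ∀ v, Allowed .manhattan v (ω v))
    (e : (ℤ × R) × Direction) (k : ℕ) : orient ((step ω)^[k] e) = orient e := by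
  induction k with
  | zero => rfl
  | succ k ih => rw [Function.iterate_succ_apply', orient_step (h _), ih]

/-- Light paths that arrive at a vertex from different sides are joined to each other by some state
of positive probability; in the Manhattan model this takes paths of different orientations. -/
theorem exists_allowed_deflect {m : Model} {v : ℤ × R} {d d' : Direction} (hd : d ≠ d')
    (h : m = .manhattan → orient (v, d') = orient (v, d) + 1) :
    ∃ s, Allowed m v s ∧ s.deflect d = d'.opp := by
  cases m
  · obtain ⟨s, hs⟩ := Site.exists_deflect_eq hd
    exact ⟨s, (by intro h; cases h), hs⟩
  · replace h := h rfl
    suffices Site.empty.deflect d = d'.opp ∨ (mirror v).deflect d = d'.opp by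
      rcases this with h | h
      · exact ⟨_, fun _ => Or.inl rfl, h⟩
      · exact ⟨_, fun _ => Or.inr rfl, h⟩
    revert h hd
    unfold mirror orient
    generalize (v.1 : ZMod 2) = a
    generalize par v.2 = b
    cases d <;> cases d' <;> simp only <;> revert a b <;> decide

/-- The law of a configuration on `ℤ × R`. -/
def cfgLaw (m : Model) (p : ℝ) (R : Type*) [CommRing R] [RowParity R] : Measure (ℤ × R → Site) :=
  Measure.infinitePi fun v : ℤ × R => law p m v

theorem configLaw_eq (m : Model) (n : ℕ) (p : ℝ) : configLaw m n p = cfgLaw m p (ZMod (2 * n)) := by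
  unfold configLaw cfgLaw
  congr 1
  funext v
  exact siteLaw_eq p m v

variable {p : ℝ} [hp : Fact (0 < p ∧ p < 1)]

instance (m : Model) (v : ℤ × R) : IsProbabilityMeasure (law p m v) := by
  obtain ⟨h0, h1⟩ := hp.out
  have h2 : (0 : ℝ) ≤ 1 - p := by linarith
  have h3 : (0 : ℝ) ≤ p / 2 := by linarith
  constructor
  cases m
  · simp only [law, Measure.add_apply, Measure.smul_apply, measure_univ, smul_eq_mul, mul_one]
    rw [← ENNReal.ofReal_add h2 h3, ← ENNReal.ofReal_add (by linarith) h3, ← ENNReal.ofReal_one]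
    congr 1
    ring
  · simp only [law, Measure.add_apply, Measure.smul_apply, measure_univ, smul_eq_mul, mul_one]
    rw [← ENNReal.ofReal_add h2 h0.le, ← ENNReal.ofReal_one]
    congr 1
    ring

instance (m : Model) : IsProbabilityMeasure (cfgLaw m p R) := by
  unfold cfgLaw; infer_instance

/-- A lower bound for the probability of the states of positive probability. -/
def minProb (p : ℝ) : ℝ := min (p / 2) (1 - p)

theorem minProb_pos : 0 < minProb p := by
  obtain ⟨h0, h1⟩ := hp.out
  exact lt_min (by linarith) (by linarith)

theorem minProb_le_one : minProb p ≤ 1 := by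
  obtain ⟨h0, h1⟩ := hp.out
  exact (min_le_right _ _).trans (by linarith)

theorem minProb_le_of_allowed {m : Model} {v : ℤ × R} {s : Site} (h : Allowed m v s) :
    minProb p ≤ (law p m v).real {s} := by
  obtain ⟨h0, h1⟩ := hp.out
  have h2 : (0 : ℝ) ≤ 1 - p := by linarith
  have h3 : (0 : ℝ) ≤ p / 2 := by linarith
  have hle1 : minProb p ≤ p / 2 := min_le_left _ _
  have hle2 : minProb p ≤ 1 - p := min_le_right _ _
  rw [measureReal_def, ← ENNReal.ofReal_le_iff_le_toReal (measure_ne_top _ _)]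
  have hd : ∀ s t : Site, Measure.dirac s {t} = if s = t then 1 else 0 := by
    intro s t
    rw [Measure.dirac_apply' _ MeasurableSpace.measurableSet_top]
    simp [Set.indicator_apply]
  cases m
  · simp only [law, Measure.add_apply, Measure.smul_apply, smul_eq_mul, hd]
    cases s <;> simp <;> exact ENNReal.ofReal_le_ofReal (by assumption)
  · simp only [law, Measure.add_apply, Measure.smul_apply, smul_eq_mul, hd]
    rcases h rfl with rfl | rfl
    · refine le_trans (ENNReal.ofReal_le_ofReal hle2) ?_
      simp
    · refine le_trans (ENNReal.ofReal_le_ofReal (hle1.trans (by linarith : p / 2 ≤ p))) ?_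
      simp

theorem ae_allowed [Countable R] (m : Model) :
    ∀ᵐ ω ∂(cfgLaw m p R), ∀ v, Allowed m v (ω v) := by
  rw [ae_all_iff]
  intro v
  have h1 : ∀ᵐ s ∂(law p m v), Allowed m v s := by
    cases m
    · exact Filter.Eventually.of_forall fun s => (by intro h; cases h)
    · rw [ae_iff]
      simp [law, Allowed, Measure.dirac_apply' _ (MeasurableSpace.measurableSet_top)]
  have h2 := Measure.infinitePi_map_eval (fun v : ℤ × R => law p m v) v
  rw [← h2] at h1
  exact ae_of_ae_map (measurable_pi_apply v).aemeasurable h1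

end Models

/-! ### Joining independent light paths -/

section Splice

variable {R : Type*} [CommRing R] [RowParity R] {p : ℝ} [hp : Fact (0 < p ∧ p < 1)]

/-- Suppose that every light path from `e` in the event `E` meets every light path from `e'` in
the event `E'`, when the two paths are taken in two different configurations. As the second path
does not depend on the first one before it meets it, the paths meet with at least the probability
`ℙ(E) ℙ(E')` in the same configuration, and changing the state of one vertex then joins `e` to the
reverse of `e'`. -/
theorem splice [Countable R] (m : Model) {D : Finset (ℤ × R)} {e e' : (ℤ × R) × Direction}
    (he : e.1 ∉ D) (he' : e'.1 ∉ D) (hne : e ≠ e') (hor : m = .manhattan → orient e' = orient e + 1)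
    {E E' : Set (ℤ × R → Site)}
    (hE : ∀ ω ω', (∀ v ∈ visited ω D e, ω v = ω' v) → ω ∈ E → ω' ∈ E)
    (hmeet : ∀ ω ∈ E, ∀ ω' ∈ E', ¬ Disjoint (visited ω D e) (visited ω' D e')) :
    minProb p * ((cfgLaw m p R).real E * (cfgLaw m p R).real E') ≤
      3 * D.card * (cfgLaw m p R).real {ω | Joins ω D e (rev e')} := by
  classical
  let H : Set (ℤ × R → Site) := {ω | ¬ Disjoint (visited ω D e) (visited ω D e')}
  have hH : Determined H (D : Set (ℤ × R)) := determined_visited D e e' fun A B => ¬ Disjoint A B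
  have h1 : (cfgLaw m p R).real E' * (cfgLaw m p R).real E ≤ (cfgLaw m p R).real H := by
    refine mul_measureReal_le_of_exploration (fun v : ℤ × R => law p m v) (D := D) (D' := D)
      (A := fun ω => visited ω D e) (fun ω => visited_subset ω D e)
      (fun ω ω' h => visited_congr h) hE hH.measurableSet fun ω hω => ?_
    refine ⟨{ω' | ¬ Disjoint (visited ω D e) (visited ω' D e')}, ?_, ?_, ?_⟩
    · intro ω₁ ω₂ h12 hmem hdisj
      -- a path in `ω₂` that avoids the explored vertices is a path in `ω₁` as well
      refine hmem ?_
      have : visited ω₁ D e' = visited ω₂ D e' := by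
        refine visited_congr fun v hv => (h12 v ⟨visited_subset _ _ _ hv, fun hv' => ?_⟩).symm
        exact Finset.disjoint_left.mp hdisj hv' hv
      rwa [this]
    · exact measureReal_mono fun ω' hω' => hmeet ω hω ω' hω'
    · intro ω' hagree hω'
      change ¬ Disjoint _ _
      rwa [visited_congr hagree]
  have h2 : (cfgLaw m p R).real H ≤
      (cfgLaw m p R).real (H ∩ {ω | ∀ v, Allowed m v (ω v)}) := by
    refine ENNReal.toReal_mono (measure_ne_top _ _) ?_
    refine measure_mono_ae ?_
    filter_upwards [ae_allowed (p := p) (R := R) m] with ω hω h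
    exact ⟨h, hω⟩
  have h3 : minProb p * (cfgLaw m p R).real (H ∩ {ω | ∀ v, Allowed m v (ω v)}) ≤
      3 * D.card * (cfgLaw m p R).real {ω | Joins ω D e (rev e')} := by
    refine mul_measureReal_le_of_update (fun v : ℤ × R => law p m v) (determined_joins _ _ _) ?_
    rintro ω ⟨hω, hall⟩
    obtain ⟨v, hv, s, hs, hj⟩ := exists_update_joins (ok := Allowed m) he he' hne
      (Finset.not_disjoint_iff_nonempty_inter.mp hω) (fun i j hij _ _ hd => by
        refine exists_allowed_deflect hd fun hm => ?_
        subst hm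
        have hi := orient_eq_tgt ((step ω)^[i] e).1 ((step ω)^[i] e).2
        have hj := orient_eq_tgt ((step ω)^[j] e').1 ((step ω)^[j] e').2
        change orient (tgt ((step ω)^[i] e), _) = orient ((step ω)^[i] e) at hi
        change orient (tgt ((step ω)^[j] e'), _) = orient ((step ω)^[j] e') at hj
        rw [hi, hij, hj, orient_iterate hall, orient_iterate hall, hor rfl])
    exact ⟨v, hv, s, minProb_le_of_allowed hs, hj⟩
  have hc : 0 ≤ minProb p := (minProb_pos (p := p)).le
  calc minProb p * ((cfgLaw m p R).real E * (cfgLaw m p R).real E')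
      ≤ minProb p * (cfgLaw m p R).real (H ∩ {ω | ∀ v, Allowed m v (ω v)}) :=
        mul_le_mul_of_nonneg_left ((mul_comm _ _).le.trans (h1.trans h2)) hc
    _ ≤ _ := h3

end Splice

/-! ### Symmetries of the models and covering maps -/

/-- Exchange of the two kinds of mirrors. -/
def Site.swap : Site → Site
  | .empty => .empty
  | .nw => .ne
  | .ne => .nw

/-- A map between two lattices that respects the edges, up to a change `dir` of the directions, and
the law of the configurations, up to a change `site` of the states. -/
structure Symm (m : Model) (R R' : Type*) [CommRing R] [RowParity R] [CommRing R']
    [RowParity R'] where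
  /-- The image of a vertex. -/
  map : ℤ × R → ℤ × R'
  /-- The image of a direction. -/
  dir : Direction → Direction
  /-- The state of a vertex in terms of that of its image. -/
  site : Site → Site
  map_hop : ∀ v d, map (hop v d) = hop (map v) (dir d)
  dir_deflect : ∀ s d, dir ((site s).deflect d) = s.deflect (dir d)
  map_law : ∀ (p : ℝ) v, (law p m (map v)).map site = law p m v

section Symm

variable {R R' : Type*} [CommRing R] [RowParity R] [CommRing R'] [RowParity R'] {m : Model}

/-- The image of a directed edge. -/
def Symm.edge (S : Symm m R R') (e : (ℤ × R) × Direction) : (ℤ × R') × Direction :=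
  (S.map e.1, S.dir e.2)

/-- The configuration seen through a symmetry. -/
def Symm.pull (S : Symm m R R') (ω : ℤ × R' → Site) : ℤ × R → Site :=
  fun v => S.site (ω (S.map v))

theorem Symm.tgt_edge (S : Symm m R R') (e : (ℤ × R) × Direction) :
    tgt (S.edge e) = S.map (tgt e) := (S.map_hop _ _).symm

theorem Symm.step_edge (S : Symm m R R') (ω : ℤ × R' → Site) (e : (ℤ × R) × Direction) :
    step ω (S.edge e) = S.edge (step (S.pull ω) e) := by
  rw [step, S.tgt_edge]
  exact Prod.ext rfl (S.dir_deflect _ _).symm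

theorem Symm.joins (S : Symm m R R') {ω : ℤ × R' → Site} {D : Set (ℤ × R)} {D' : Set (ℤ × R')}
    {e f : (ℤ × R) × Direction} (h : Joins (S.pull ω) D e f) (hD : ∀ v ∈ D, S.map v ∈ D') :
    Joins ω D' (S.edge e) (S.edge f) := by
  obtain ⟨k, rfl, hk⟩ := h
  have h1 : ∀ i, (step ω)^[i] (S.edge e) = S.edge ((step (S.pull ω))^[i] e) := by
    intro i
    induction i with
    | zero => rfl
    | succ i ih => rw [Function.iterate_succ_apply', Function.iterate_succ_apply', ih, S.step_edge]
  exact ⟨k, h1 k, fun i hi => by rw [h1, S.tgt_edge]; exact hD _ (hk i hi)⟩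

variable {p : ℝ} [hp : Fact (0 < p ∧ p < 1)]

theorem Symm.measureReal_pull (S : Symm m R R') {D : Finset (ℤ × R)} (hS : Set.InjOn S.map D)
    {E : Set (ℤ × R → Site)} (hE : Determined E D) :
    (cfgLaw m p R').real {ω | S.pull ω ∈ E} = (cfgLaw m p R).real E :=
  measureReal_pullback (fun v : ℤ × R' => law p m v) (fun v : ℤ × R => law p m v) S.map S.site hS
    (S.map_law p) hE

theorem Symm.measureReal_joins_le (S : Symm m R R') {D : Finset (ℤ × R)}
    (hS : Set.InjOn S.map D) {D' : Set (ℤ × R')} (hD : ∀ v ∈ D, S.map v ∈ D')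
    (e f : (ℤ × R) × Direction) :
    (cfgLaw m p R).real {ω | Joins ω D e f} ≤
      (cfgLaw m p R').real {ω | Joins ω D' (S.edge e) (S.edge f)} := by
  rw [← S.measureReal_pull hS (determined_joins _ _ _)]
  exact measureReal_mono fun ω hω => S.joins hω hD

theorem law_map_swap (p : ℝ) {v : ℤ × R} {v' : ℤ × R'}
    (h : m = .manhattan → (v'.1 : ZMod 2) + par v'.2 = v.1 + par v.2 + 1) :
    (law p m v').map Site.swap = law p m v := by
  have hs : Measurable Site.swap := measurable_of_finite _
  cases m
  · simp only [law, Measure.map_add _ _ hs, Measure.map_smul, Measure.map_dirac' hs, Site.swap]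
    exact add_right_comm _ _ _
  · have hm : (mirror v').swap = mirror v := by
      unfold mirror
      rw [h rfl]
      generalize (v.1 : ZMod 2) + par v.2 = a
      revert a
      decide
    simp only [law, Measure.map_add _ _ hs, Measure.map_smul, Measure.map_dirac' hs, hm]
    rfl

theorem law_eq_of_parity (p : ℝ) {v : ℤ × R} {v' : ℤ × R'}
    (h : m = .manhattan → (v'.1 : ZMod 2) + par v'.2 = v.1 + par v.2) :
    law p m v' = law p m v := by
  cases m
  · rfl
  · simp only [law, mirror, h rfl]

/-- The translation `(x, z) ↦ (x + t, z + c)`, followed by the covering map from the plane. -/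
def Symm.shift (m : Model) (R : Type*) [CommRing R] [RowParity R] (t c : ℤ)
    (h : m = .manhattan → (t : ZMod 2) + c = 0) : Symm m ℤ R where
  map v := (v.1 + t, ((v.2 + c : ℤ) : R))
  dir := id
  site := id
  map_hop v d := by cases d <;> simp [hop] <;> ring
  dir_deflect s d := rfl
  map_law p v := by
    rw [Measure.map_id]
    refine law_eq_of_parity p fun hm => ?_
    have h2 : par v.2 = (v.2 : ZMod 2) := rfl
    rw [map_intCast, h2]
    push_cast
    linear_combination h hm

/-- The reflection `(x, z) ↦ (x + t, c - z)`, followed by the covering map from the plane. -/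
def Symm.flip (m : Model) (R : Type*) [CommRing R] [RowParity R] (t c : ℤ)
    (h : m = .manhattan → (t : ZMod 2) + c = 1) : Symm m ℤ R where
  map v := (v.1 + t, ((c - v.2 : ℤ) : R))
  dir
    | .east => .east
    | .north => .south
    | .west => .west
    | .south => .north
  site := Site.swap
  map_hop v d := by cases d <;> simp [hop] <;> ring
  dir_deflect s d := by cases s <;> cases d <;> rfl
  map_law p v := by
    refine law_map_swap p fun hm => ?_
    have h2 : par v.2 = (v.2 : ZMod 2) := rfl
    rw [map_intCast, h2]
    push_cast
    rw [sub_eq_add_neg, ZMod.neg_eq_self_mod_two]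
    linear_combination h hm

/-- The rotation `(x, z) ↦ (c - z, x + c')` of the plane. -/
def Symm.rot (m : Model) (c c' : ℤ) (h : m = .manhattan → (c : ZMod 2) + c' = 1) :
    Symm m ℤ ℤ where
  map v := (c - v.2, v.1 + c')
  dir
    | .east => .north
    | .north => .west
    | .west => .south
    | .south => .east
  site := Site.swap
  map_hop v d := by cases d <;> simp [hop] <;> ring
  dir_deflect s d := by cases s <;> cases d <;> rfl
  map_law p v := by
    refine law_map_swap p fun hm => ?_
    have h2 : ∀ z : ℤ, par z = (z : ZMod 2) := fun z => rfl
    rw [h2, h2]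
    push_cast
    rw [sub_eq_add_neg, ZMod.neg_eq_self_mod_two]
    linear_combination h hm

end Symm

/-! ### Paths that cross a box of the plane -/

section Crossing

/-- The number of times, counted with sign, that the lattice path `a 0, …, a (k + 1)` crosses the
vertical half-line that goes down from `v`, moved to the right by one half and down by one half. -/
def crossings (a : ℕ → ℤ × ℤ) (k : ℕ) (v : ℤ × ℤ) : ℤ :=
  ∑ i ∈ Finset.range (k + 1), if (a i).2 < v.2 then
    (if v.1 < (a (i + 1)).1 then 1 else 0) - (if v.1 < (a i).1 then 1 else 0) else 0

theorem crossings_up {a : ℕ → ℤ × ℤ} {k : ℕ} (hstep : ∀ i ≤ k, ∃ d, a (i + 1) = hop (a i) d)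
    {x z : ℤ} (hv : ∀ i ≤ k + 1, a i ≠ (x, z)) :
    crossings a k (x, z + 1) = crossings a k (x, z) := by
  refine Finset.sum_congr rfl fun i hi => ?_
  rw [Finset.mem_range] at hi
  obtain ⟨d, hd⟩ := hstep i (by omega)
  have h0 := hv i (by omega)
  have h1 := hv (i + 1) (by omega)
  rw [hd] at h1 ⊢
  generalize a i = w at *
  obtain ⟨b, c⟩ := w
  cases d <;> simp only [hop, ne_eq, Prod.mk.injEq, not_and] at h0 h1 ⊢ <;> split_ifs <;> omega

theorem crossings_right {a : ℕ → ℤ × ℤ} {k : ℕ} (hstep : ∀ i ≤ k, ∃ d, a (i + 1) = hop (a i) d)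
    {x z : ℤ} (hv : ∀ i ≤ k + 1, a i ≠ (x, z)) (h0 : (a 0).1 ≠ x) (h1 : (a (k + 1)).1 ≠ x) :
    crossings a k (x - 1, z) = crossings a k (x, z) := by
  rw [← sub_eq_zero, crossings, crossings, ← Finset.sum_sub_distrib]
  have htel := Finset.sum_range_sub
    (fun i => if (a i).1 = x ∧ (a i).2 < z then (1 : ℤ) else 0) (k + 1)
  simp only [h0, h1, false_and, if_false, sub_zero] at htel
  rw [← htel]
  refine Finset.sum_congr rfl fun i hi => ?_
  rw [Finset.mem_range] at hi
  obtain ⟨d, hd⟩ := hstep i (by omega)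
  have h0 := hv i (by omega)
  have h1 := hv (i + 1) (by omega)
  rw [hd] at h1 ⊢
  generalize a i = w at *
  obtain ⟨b, c⟩ := w
  cases d <;> simp only [hop, ne_eq, Prod.mk.injEq, not_and] at h0 h1 ⊢ <;> split_ifs <;> omega

/-- A lattice path `a` that crosses the columns `1, …, L` from left to right meets every lattice
path `b` in these columns that starts below `a` and ends either above `a` or on the left of the
columns, at a higher place than the start of `a`. -/
theorem exists_eq_of_crossing {L z₀ : ℤ} {a b : ℕ → ℤ × ℤ} {k l : ℕ}
    (hastep : ∀ i ≤ k, ∃ d, a (i + 1) = hop (a i) d)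
    (hbstep : ∀ i ≤ l, ∃ d, b (i + 1) = hop (b i) d)
    (ha0 : (a 0).1 = 0) (ha : ∀ i, 1 ≤ i → i ≤ k → 1 ≤ (a i).1 ∧ (a i).1 ≤ L)
    (ha1 : (a (k + 1)).1 = L + 1) (haz : ∀ i ≤ k + 1, z₀ < (a i).2)
    (hb0 : (b 0).2 = z₀) (hb : ∀ i ≤ l, 1 ≤ (b i).1 ∧ (b i).1 ≤ L)
    (hb1 : (1 ≤ (b (l + 1)).1 ∧ (b (l + 1)).1 ≤ L ∧ ∀ i ≤ k + 1, (a i).2 < (b (l + 1)).2) ∨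
      ((b (l + 1)).1 = 0 ∧ (a 0).2 < (b (l + 1)).2)) :
    ∃ i j, 1 ≤ i ∧ i ≤ k ∧ 1 ≤ j ∧ j ≤ l ∧ a i = b j := by
  by_contra! hcon
  have hdisj : ∀ j ≤ l + 1, ∀ i ≤ k + 1, a i ≠ b j := by
    intro j hj i hi h
    rcases Nat.eq_zero_or_pos j with rfl | hj0
    · have := haz i hi
      rw [h] at this
      omega
    rcases Nat.lt_or_ge l j with hjl | hjl
    · obtain rfl : j = l + 1 := by omega
      rcases hb1 with ⟨_, _, h'⟩ | ⟨h', h''⟩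
      · have := h' i hi
        rw [h] at this
        omega
      · rcases Nat.eq_zero_or_pos i with rfl | hi0
        · rw [h] at h''; omega
        · rcases Nat.lt_or_ge k i with hik | hik
          · obtain rfl : i = k + 1 := by omega
            have h2 := hb 0 (by omega)
            rw [h] at ha1
            omega
          · have := ha i hi0 hik
            rw [h] at this
            omega
    · have h2 := hb j hjl
      rcases Nat.eq_zero_or_pos i with rfl | hi0
      · rw [h] at ha0; omega
      · rcases Nat.lt_or_ge k i with hik | hik
        · obtain rfl : i = k + 1 := by omega
          rw [h] at ha1
          omega
        · exact hcon i j hi0 hik hj0 hjl h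
  have hinv : ∀ j ≤ l + 1, crossings a k (b j) = crossings a k (b 0) := by
    intro j
    induction j with
    | zero => intro _; rfl
    | succ j ih =>
      intro hj
      rw [← ih (by omega)]
      have h0 := hdisj j (by omega)
      have h1 := hdisj (j + 1) hj
      have hc := hb j (by omega)
      have hcol : 0 ≤ (b (j + 1)).1 ∧ (b (j + 1)).1 ≤ L := by
        rcases Nat.lt_or_ge l (j + 1) with hjl | hjl
        · obtain rfl : j = l := by omega
          omega
        · have := hb (j + 1) hjl
          omega
      obtain ⟨d, hd⟩ := hbstep j (by omega)
      rw [hd] at h1 hcol ⊢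
      generalize b j = w at *
      obtain ⟨x, z⟩ := w
      cases d <;> simp only [hop] at h1 hcol hc ⊢
      · have := crossings_right hastep h1 (by omega) (by omega)
        rw [← this, add_sub_cancel_right]
      · exact crossings_up hastep h0
      · exact crossings_right hastep h0 (by omega) (by omega)
      · rw [← crossings_up hastep h1, sub_add_cancel]
  have hstart : crossings a k (b 0) = 0 := by
    refine Finset.sum_eq_zero fun i hi => if_neg ?_
    rw [Finset.mem_range] at hi
    have := haz i (by omega)
    omega
  have hend : crossings a k (b (l + 1)) = 1 := by
    rcases hb1 with ⟨h1, h2, h3⟩ | ⟨h1, h2⟩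
    · have htel := Finset.sum_range_sub
        (fun i => if (b (l + 1)).1 < (a i).1 then (1 : ℤ) else 0) (k + 1)
      rw [if_pos (by omega), if_neg (by omega), sub_zero] at htel
      rw [← htel]
      refine Finset.sum_congr rfl fun i hi => if_pos ?_
      rw [Finset.mem_range] at hi
      exact h3 i (by omega)
    · have hpos : ∀ i, 1 ≤ i → i ≤ k + 1 → 0 < (a i).1 := by
        intro i hi hi'
        rcases Nat.lt_or_ge k i with hik | hik
        · obtain rfl : i = k + 1 := by omega
          have := hb 0 (by omega)
          omega
        · have := ha i hi hik
          omega
      rw [crossings, Finset.sum_range_succ', Finset.sum_eq_zero, zero_add, if_pos h2, h1,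
        if_pos (hpos 1 le_rfl (by omega)), if_neg (by omega), sub_zero]
      intro i hi
      rw [Finset.mem_range] at hi
      rw [h1, if_pos (hpos (i + 1) (by omega) (by omega)),
        if_pos (hpos (i + 1 + 1) (by omega) (by omega)), sub_self, ite_self]
  have := hinv (l + 1) le_rfl
  omega

end Crossing

/-! ### Joining two entries of a square -/

section Exits

variable {R R' : Type*} [CommRing R] [CommRing R']

/-- Light that comes in through `e` leaves `D` in the direction `d`. -/
def exitDir (D : Set (ℤ × R)) (e : (ℤ × R) × Direction) (d : Direction) : Set (ℤ × R → Site) :=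
  {ω | ∃ f, Joins ω D e f ∧ tgt f ∉ D ∧ f.2 = d}

theorem determined_exitDir (D : Set (ℤ × R)) (e : (ℤ × R) × Direction) (d : Direction) :
    Determined (exitDir D e d) D := by
  rintro ω ω' hω ⟨f, hf, h⟩
  exact ⟨f, hf.congr hω, h⟩

theorem exitDir_congr_visited {ω ω' : ℤ × R → Site} {D : Finset (ℤ × R)}
    {e : (ℤ × R) × Direction} {d : Direction} (h : ∀ v ∈ visited ω D e, ω v = ω' v)
    (hω : ω ∈ exitDir D e d) : ω' ∈ exitDir D e d := by
  obtain ⟨f, hf, h'⟩ := hω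
  exact ⟨f, hf.congr_visited subset_rfl h, h'⟩

theorem visited_rev_subset {ω : ℤ × R → Site} {D : Finset (ℤ × R)} {e f : (ℤ × R) × Direction}
    (h : Joins ω D e f) (he : e.1 ∉ D) : visited ω D (rev f) ⊆ visited ω D e := by
  intro v hv
  rw [mem_visited] at hv
  obtain ⟨j, hj, rfl⟩ := hv
  obtain ⟨k, hk, hkD⟩ := h.reverse
  have hjk : j < k := by
    by_contra! hkj
    have := hj k hkj
    rw [hk, tgt_rev] at this
    exact he this
  have h1 : Joins ω D ((step ω)^[j] (rev f)) (rev e) := by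
    refine ⟨k - j, ?_, fun i hi => ?_⟩
    · rw [← Function.iterate_add_apply, Nat.sub_add_cancel hjk.le, hk]
    · rw [← Function.iterate_add_apply]
      exact hkD _ (by omega)
  have h2 := h1.reverse
  rw [rev_rev] at h2
  exact h2.source_mem_visited (hj j le_rfl) he

variable [RowParity R] [RowParity R'] {m : Model} {p : ℝ} [hp : Fact (0 < p ∧ p < 1)]

theorem Symm.measureReal_exitDir_le (S : Symm m R R') {D : Finset (ℤ × R)}
    (hS : Set.InjOn S.map D) {D' : Set (ℤ × R')} (hD : ∀ v, S.map v ∈ D' ↔ v ∈ D)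
    (e : (ℤ × R) × Direction) (d : Direction) :
    (cfgLaw m p R).real (exitDir D e d) ≤
      (cfgLaw m p R').real (exitDir D' (S.edge e) (S.dir d)) := by
  rw [← S.measureReal_pull hS (determined_exitDir _ _ _)]
  refine measureReal_mono ?_
  rintro ω ⟨f, hf, hf', hd⟩
  refine ⟨S.edge f, S.joins hf fun v hv => (hD v).mpr hv, ?_, congrArg S.dir hd⟩
  rw [S.tgt_edge, hD]
  exact hf'

end Exits

section Square

/-- The square `{1, …, L} × {z₀ + 1, …, z₀ + L}` of the plane. -/
def square (L : ℕ) (z₀ : ℤ) : Finset (ℤ × ℤ) :=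
  Finset.Icc (1 : ℤ) L ×ˢ Finset.Icc (z₀ + 1) (z₀ + L)

theorem mem_square {L : ℕ} {z₀ : ℤ} {v : ℤ × ℤ} :
    v ∈ square L z₀ ↔ (1 ≤ v.1 ∧ v.1 ≤ L) ∧ z₀ + 1 ≤ v.2 ∧ v.2 ≤ z₀ + L := by
  rw [square, Finset.mem_product, Finset.mem_Icc, Finset.mem_Icc]

theorem card_square (L : ℕ) (z₀ : ℤ) : (square L z₀).card = L * L := by
  rw [square, Finset.card_product, Int.card_Icc, Int.card_Icc]
  congr 1 <;> omega

/-- The part of the square below its horizontal axis of symmetry. -/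
def lowerHalf (L : ℕ) (z₀ : ℤ) : Finset (ℤ × ℤ) :=
  (square L z₀).filter fun v => 2 * v.2 < 2 * z₀ + L + 1

/-- The part of the square above its horizontal axis of symmetry. -/
def upperHalf (L : ℕ) (z₀ : ℤ) : Finset (ℤ × ℤ) :=
  (square L z₀).filter fun v => 2 * z₀ + L + 1 < 2 * v.2

theorem mem_lowerHalf {L : ℕ} {z₀ : ℤ} {v : ℤ × ℤ} : v ∈ lowerHalf L z₀ ↔
    ((1 ≤ v.1 ∧ v.1 ≤ L) ∧ z₀ + 1 ≤ v.2 ∧ v.2 ≤ z₀ + L) ∧ 2 * v.2 < 2 * z₀ + L + 1 := by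
  rw [lowerHalf, Finset.mem_filter, mem_square]

theorem mem_upperHalf {L : ℕ} {z₀ : ℤ} {v : ℤ × ℤ} : v ∈ upperHalf L z₀ ↔
    ((1 ≤ v.1 ∧ v.1 ≤ L) ∧ z₀ + 1 ≤ v.2 ∧ v.2 ≤ z₀ + L) ∧ 2 * z₀ + L + 1 < 2 * v.2 := by
  rw [upperHalf, Finset.mem_filter, mem_square]

/-- The edge that comes in from the column `0` at height `y`, heading east. -/
def entry {R : Type*} [CommRing R] (t : ℤ) (y : R) : (ℤ × R) × Direction := ((t, y), .east)

/-- In a square, a light path from the left side to the right side meets every light path that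
comes in through the bottom and leaves either through the top, or through the left side at a higher
place than where the first path came in. -/
theorem not_disjoint_visited {L : ℕ} {z₀ y x₀ : ℤ} (hy : z₀ < y) (hyL : y ≤ z₀ + L) (hx : 1 ≤ x₀)
    (hxL : x₀ ≤ L) {ω ω' : ℤ × ℤ → Site} (hω : ω ∈ exitDir (square L z₀) (entry 0 y) .east)
    {g : (ℤ × ℤ) × Direction} (hg : Joins ω' (square L z₀) ((x₀, z₀), .north) g)
    (hgD : tgt g ∉ square L z₀) (hg' : g.2 = .north ∨ (tgt g).1 = 0 ∧ y < (tgt g).2) :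
    ¬ Disjoint (visited ω (square L z₀) (entry 0 y))
      (visited ω' (square L z₀) ((x₀, z₀), .north)) := by
  obtain ⟨f, hf, hfD, hfd⟩ := hω
  have he : (entry 0 y).1 ∉ square L z₀ := by
    rw [mem_square]; simp [entry]
  have he3 : (((x₀, z₀), .north) : (ℤ × ℤ) × Direction).1 ∉ square L z₀ := by
    rw [mem_square]; simp
  have hf1 : f.1 ∈ square L z₀ := by
    rcases hf.eq_or_source_mem with rfl | h
    · exfalso
      apply hfD
      rw [Finset.mem_coe, mem_square]
      simp only [entry, tgt, hop]
      omega
    · exact h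
  have hg1 : g.1 ∈ square L z₀ ∨ g = ((x₀, z₀), .north) := hg.eq_or_source_mem.symm
  obtain ⟨k, hk, hkD⟩ := hf
  obtain ⟨l, hl, hlD⟩ := hg
  have hstep : ∀ (ω : ℤ × ℤ → Site) e i, ((step ω)^[i + 1] e).1 = tgt ((step ω)^[i] e) := by
    intro ω e i
    rw [Function.iterate_succ_apply']
    rfl
  have haD : ∀ i, 1 ≤ i → i ≤ k → ((step ω)^[i] (entry 0 y)).1 ∈ square L z₀ := by
    intro i hi hik
    obtain ⟨i, rfl⟩ := Nat.exists_eq_add_of_le' hi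
    rw [hstep]
    exact hkD i (by omega)
  have hbD : ∀ i, 1 ≤ i → i ≤ l →
      ((step ω')^[i] ((x₀, z₀), .north)).1 ∈ square L z₀ := by
    intro i hi hik
    obtain ⟨i, rfl⟩ := Nat.exists_eq_add_of_le' hi
    rw [hstep]
    exact hlD i (by omega)
  have haend : ((step ω)^[k + 1] (entry 0 y)).1 = ((L : ℤ) + 1, f.1.2) := by
    rw [hstep, hk]
    rw [Finset.mem_coe, mem_square] at hfD
    rw [mem_square] at hf1
    obtain ⟨⟨x, z⟩, d⟩ := f
    simp only at hfd
    subst hfd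
    simp only [tgt, hop] at hfD hf1 ⊢
    exact Prod.ext (by simp only; omega) rfl
  have harow : ∀ i ≤ k + 1, z₀ < ((step ω)^[i] (entry 0 y)).1.2 ∧
      ((step ω)^[i] (entry 0 y)).1.2 ≤ z₀ + L := by
    intro i hi
    rcases Nat.eq_zero_or_pos i with rfl | hi0
    · exact ⟨hy, hyL⟩
    rcases Nat.lt_or_ge k i with hik | hik
    · obtain rfl : i = k + 1 := by omega
      rw [haend]
      rw [mem_square] at hf1
      simp only
      omega
    · have := haD i hi0 hik
      rw [mem_square] at this
      omega
  obtain ⟨i, j, hi, hik, hj, hjl, hij⟩ := exists_eq_of_crossing (L := L) (z₀ := z₀)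
    (a := fun i => ((step ω)^[i] (entry 0 y)).1)
    (b := fun i => ((step ω')^[i] ((x₀, z₀), .north)).1) (k := k) (l := l)
    (fun i _ => ⟨_, hstep _ _ _⟩) (fun i _ => ⟨_, hstep _ _ _⟩) rfl
    (fun i hi hik => (mem_square.mp (haD i hi hik)).1) (by simp only [haend])
    (fun i hi => (harow i hi).1) rfl
    (fun i hi => by
      rcases Nat.eq_zero_or_pos i with rfl | hi0
      · exact ⟨hx, hxL⟩
      · exact (mem_square.mp (hbD i hi0 hi)).1)
    (by
      simp only [hstep, hl]
      refine hg'.imp (fun hd => ?_) id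
      have hcol : 1 ≤ g.1.1 ∧ g.1.1 ≤ L ∧ z₀ ≤ g.1.2 := by
        rcases hg1 with h | rfl
        · rw [mem_square] at h
          omega
        · exact ⟨hx, hxL, le_rfl⟩
      rw [mem_square] at hgD
      have ht : tgt g = (g.1.1, g.1.2 + 1) := by
        rw [tgt, hd]; rfl
      rw [ht] at hgD ⊢
      simp only at hgD ⊢
      refine ⟨hcol.1, hcol.2.1, fun i hi => ?_⟩
      rcases Nat.eq_zero_or_pos i with rfl | hi0
      · change y < _
        omega
      · have := harow i hi
        omega)
  rw [Finset.not_disjoint_iff]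
  refine ⟨((step ω)^[i] (entry 0 y)).1, ?_, ?_⟩
  · exact Joins.source_mem_visited ⟨i, rfl, fun j hj => hkD j (by omega)⟩ (haD i hi hik) he
  · rw [show ((step ω)^[i] (entry 0 y)).1 = _ from hij]
    exact Joins.source_mem_visited ⟨j, rfl, fun i hi => hlD i (by omega)⟩ (hbD j hj hjl) he3

variable {m : Model} {p : ℝ} [hp : Fact (0 < p ∧ p < 1)]

theorem orient_entry {R : Type*} [CommRing R] [RowParity R] (t : ℤ) (y : R) :
    orient (entry t y) = par y := rfl

theorem intCast_eq_add_one_of_odd {y₁ y₂ : ℤ} (h : Odd (y₁ + y₂)) :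
    (y₂ : ZMod 2) = y₁ + 1 := by
  have h1 : ((y₁ + y₂ : ℤ) : ZMod 2) = 1 := by
    obtain ⟨k, hk⟩ := h
    rw [hk]
    push_cast
    have : (2 : ZMod 2) = 0 := by decide
    rw [this, zero_mul, zero_add]
  push_cast at h1
  have h2 : (y₁ : ZMod 2) + y₁ = 0 := CharTwo.add_self_eq_zero _
  linear_combination h1 - h2

/-- The reflection in the horizontal axis of the square. -/
def reflectSquare (m : Model) {L : ℕ} {z₀ y₁ y₂ : ℤ} (hs : y₁ + y₂ = 2 * z₀ + L + 1)
    (hpar : m = .manhattan → Odd (y₁ + y₂)) : Symm m ℤ ℤ :=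
  Symm.flip m ℤ 0 (2 * z₀ + L + 1) fun hm => by
    have h := intCast_eq_add_one_of_odd (hpar hm)
    have h2 := CharTwo.add_self_eq_zero (y₁ : ZMod 2)
    rw [← hs]
    push_cast
    linear_combination h + h2

theorem reflectSquare_map {L : ℕ} {z₀ y₁ y₂ : ℤ} (hs : y₁ + y₂ = 2 * z₀ + L + 1)
    (hpar : m = .manhattan → Odd (y₁ + y₂)) (v : ℤ × ℤ) :
    (reflectSquare m hs hpar).map v = (v.1, 2 * z₀ + L + 1 - v.2) := by
  simp [reflectSquare, Symm.flip]

theorem reflectSquare_injOn {L : ℕ} {z₀ y₁ y₂ : ℤ} (hs : y₁ + y₂ = 2 * z₀ + L + 1)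
    (hpar : m = .manhattan → Odd (y₁ + y₂)) (D : Set (ℤ × ℤ)) :
    Set.InjOn (reflectSquare m hs hpar).map D := by
  rintro ⟨x, z⟩ - ⟨x', z'⟩ - h
  rw [reflectSquare_map, reflectSquare_map, Prod.mk.injEq] at h
  ext <;> simp only at h ⊢ <;> omega

/-- If light from the left side of a square is likely to reach the right side, then any two entries
at symmetric heights are joined with a probability that is not much smaller: by a rotation, light
from the bottom is likely to reach the top. Such a path meets the path of the upper entry, so that
it can be joined to it. The resulting path separates the lower entry from the right side. -/
theorem le_measureReal_joins_of_exit_east {L : ℕ} {z₀ y₁ y₂ : ℤ} (hs : y₁ + y₂ = 2 * z₀ + L + 1)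
    (h12 : y₁ < y₂) (hz : z₀ < y₁) (hpar : m = .manhattan → Odd (y₁ + y₂)) {b : ℝ} (hb0 : 0 ≤ b)
    (hb : b ≤ (cfgLaw m p ℤ).real (exitDir (square L z₀) (entry 0 y₂) .east)) :
    minProb p ^ 2 * b ^ 3 ≤ (3 * (L : ℝ) ^ 2) ^ 2 *
      (cfgLaw m p ℤ).real {ω | Joins ω (square L z₀) (entry 0 y₁) (rev (entry 0 y₂))} := by
  have hc : 0 < minProb p := minProb_pos
  have hcast : m = .manhattan → (y₂ : ZMod 2) = y₁ + 1 := fun hm =>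
    intCast_eq_add_one_of_odd (hpar hm)
  have hsum : ((y₁ : ZMod 2) + y₂) = 2 * z₀ + L + 1 := by
    have := congrArg (Int.cast : ℤ → ZMod 2) hs
    push_cast at this
    exact this
  have h2 : (2 : ZMod 2) = 0 := by decide
  rw [h2, zero_mul, zero_add] at hsum
  have hself : ∀ a : ZMod 2, a + a = 0 := CharTwo.add_self_eq_zero
  -- the reflection in the horizontal axis of the square
  have hb1 : b ≤ (cfgLaw m p ℤ).real (exitDir (square L z₀) (entry 0 y₁) .east) := by
    let S := reflectSquare m hs hpar
    refine hb.trans ((S.measureReal_exitDir_le (D' := square L z₀)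
      (reflectSquare_injOn hs hpar _) ?_ _ _).trans (le_of_eq ?_))
    · intro v
      rw [reflectSquare_map, Finset.mem_coe, mem_square, mem_square]
      simp only
      omega
    · have h1 : S.edge (entry 0 y₂) = entry 0 y₁ := by
        refine Prod.ext ?_ rfl
        change S.map (0, y₂) = (0, y₁)
        rw [reflectSquare_map, ← hs]
        simp
      rw [h1]
      rfl
  -- the rotation about the centre of the square; one of the two rotated entries has the
  -- orientation that allows to join it to the upper entry
  obtain ⟨y, hy, hyL, hby, hor⟩ : ∃ y : ℤ, z₀ < y ∧ y ≤ z₀ + L ∧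
      b ≤ (cfgLaw m p ℤ).real (exitDir (square L z₀) (entry 0 y) .east) ∧
      (m = .manhattan → (z₀ : ZMod 2) + y = y₂ + 1) := by
    have h01 : (z₀ : ZMod 2) = 0 ∨ (z₀ : ZMod 2) = 1 := by
      generalize (z₀ : ZMod 2) = a
      revert a
      decide
    rcases h01 with h0 | h0
    · exact ⟨y₁, hz, by omega, hb1, fun hm => by
        rw [hcast hm, h0, add_assoc, hself, zero_add, add_zero]⟩
    · exact ⟨y₂, by omega, by omega, hb, fun _ => by rw [h0, add_comm]⟩
  have hb3 : b ≤ (cfgLaw m p ℤ).real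
      (exitDir (square L z₀) ((z₀ + L + 1 - y, z₀), .north) .north) := by
    let S : Symm m ℤ ℤ := Symm.rot m (z₀ + L + 1) z₀ fun hm => by
      push_cast
      have h3 := hself (z₀ : ZMod 2)
      rw [hcast hm, ← add_assoc, hself, zero_add] at hsum
      linear_combination h3 - hsum
    refine hby.trans ((S.measureReal_exitDir_le (D' := square L z₀) ?_ ?_ _ _).trans (le_of_eq ?_))
    · rintro ⟨x, z⟩ - ⟨x', z'⟩ - h
      simp only [S, Symm.rot, Prod.mk.injEq] at h
      ext <;> simp only <;> omega
    · rintro ⟨x, z⟩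
      simp only [S, Symm.rot, Finset.mem_coe, mem_square]
      omega
    · simp only [Symm.edge, S, Symm.rot, entry, zero_add]
  have hout1 : (entry 0 y₁).1 ∉ square L z₀ := by rw [mem_square]; simp [entry]
  have hout2 : (entry 0 y₂).1 ∉ square L z₀ := by rw [mem_square]; simp [entry]
  have hout3 : (((z₀ + L + 1 - y, z₀), .north) : (ℤ × ℤ) × Direction).1 ∉ square L z₀ := by
    rw [mem_square]; simp
  have hpz : ∀ z : ℤ, par z = (z : ZMod 2) := fun z => rfl
  have hs1 := splice (p := p) m (D := square L z₀) (e := entry 0 y₂)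
    (e' := ((z₀ + L + 1 - y, z₀), .north)) hout2 hout3 (by simp [entry])
    (fun hm => by
      rw [orient_entry, hpz, ← hor hm]
      simp only [orient]
      rw [hcast hm, ← add_assoc, hself, zero_add] at hsum
      push_cast
      have h3 := hself (y : ZMod 2)
      linear_combination hself (1 : ZMod 2) - h3 - hsum)
    (E := exitDir (square L z₀) (entry 0 y₂) .east)
    (E' := exitDir (square L z₀) ((z₀ + L + 1 - y, z₀), .north) .north)
    (fun ω ω' h => exitDir_congr_visited h)
    (fun ω hω ω' ⟨g, hg, hgD, hgd⟩ => not_disjoint_visited (by omega) (by omega) (by omega)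
      (by omega) hω hg hgD (Or.inl hgd))
  have hs2 := splice (p := p) m (D := square L z₀) (e := entry 0 y₁) (e' := entry 0 y₂) hout1 hout2
    (by simp only [entry, ne_eq, Prod.mk.injEq]; omega)
    (fun hm => by rw [orient_entry, orient_entry, hpz, hpz, hcast hm])
    (E := exitDir (square L z₀) (entry 0 y₁) .east)
    (E' := {ω | Joins ω (square L z₀) (entry 0 y₂) (rev ((z₀ + L + 1 - y, z₀), .north))})
    (fun ω ω' h => exitDir_congr_visited h)
    (fun ω hω ω' hω' hdisj => by
      have h1 := hω'.reverse
      rw [rev_rev] at h1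
      refine not_disjoint_visited (g := rev (entry 0 y₂)) hz (by omega) (by omega)
        (by omega) hω h1 (by rw [tgt_rev]; exact hout2) (Or.inr ?_)
        (Finset.disjoint_of_subset_right ?_ hdisj)
      · rw [tgt_rev]
        exact ⟨rfl, h12⟩
      · have := visited_rev_subset hω' hout2
        rwa [rev_rev] at this)
  rw [card_square] at hs1 hs2
  push_cast at hs1 hs2
  set P1 := (cfgLaw m p ℤ).real
    {ω | Joins ω (square L z₀) (entry 0 y₂) (rev ((z₀ + L + 1 - y, z₀), .north))}
  set P2 := (cfgLaw m p ℤ).real {ω | Joins ω (square L z₀) (entry 0 y₁) (rev (entry 0 y₂))}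
  have hP1 : 0 ≤ P1 := measureReal_nonneg
  have e1 : minProb p * (b * b) ≤ 3 * (L * L) * P1 :=
    (mul_le_mul_of_nonneg_left (mul_le_mul hb hb3 hb0 measureReal_nonneg) hc.le).trans hs1
  have e2 : minProb p * (b * P1) ≤ 3 * (L * L) * P2 :=
    (mul_le_mul_of_nonneg_left (mul_le_mul_of_nonneg_right hb1 hP1) hc.le).trans hs2
  have hL : (0 : ℝ) ≤ 3 * (L * L) := by positivity
  calc minProb p ^ 2 * b ^ 3 = minProb p * b * (minProb p * (b * b)) := by ring
    _ ≤ minProb p * b * (3 * (L * L) * P1) :=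
        mul_le_mul_of_nonneg_left e1 (mul_nonneg hc.le hb0)
    _ = 3 * (L * L) * (minProb p * (b * P1)) := by ring
    _ ≤ 3 * (L * L) * (3 * (L * L) * P2) := mul_le_mul_of_nonneg_left e2 hL
    _ = (3 * (L : ℝ) ^ 2) ^ 2 * P2 := by ring

end Square

section SquareJoin

variable {m : Model} {p : ℝ} [hp : Fact (0 < p ∧ p < 1)]

/-- If light from the lower entry is likely to reach the horizontal axis of the square, then so is
light from the upper entry, and both paths are likely to reach it at the same place. -/
theorem le_measureReal_joins_of_exit_north {L : ℕ} {z₀ y₁ y₂ : ℤ}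
    (hs : y₁ + y₂ = 2 * z₀ + L + 1) (h12 : y₁ < y₂) (hz : z₀ < y₁)
    (hpar : m = .manhattan → Odd (y₁ + y₂)) {b : ℝ} (hb0 : 0 ≤ b)
    (hb : b ≤ (cfgLaw m p ℤ).real (exitDir (lowerHalf L z₀) (entry 0 y₁) .north)) :
    minProb p * b ^ 2 ≤ 3 * (L : ℝ) ^ 4 *
      (cfgLaw m p ℤ).real {ω | Joins ω (square L z₀) (entry 0 y₁) (rev (entry 0 y₂))} := by
  have hc : 0 < minProb p := minProb_pos
  have hL0 : (0 : ℝ) < L := by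
    have : 0 < L := by omega
    exact_mod_cast this
  have hlow : ((lowerHalf L z₀ : Finset (ℤ × ℤ)) : Set (ℤ × ℤ)) ⊆ square L z₀ := by
    rw [Finset.coe_subset]; exact Finset.filter_subset _ _
  have hupp : ((upperHalf L z₀ : Finset (ℤ × ℤ)) : Set (ℤ × ℤ)) ⊆ square L z₀ := by
    rw [Finset.coe_subset]; exact Finset.filter_subset _ _
  obtain ⟨h, hh1, hh2⟩ : ∃ h : ℤ, 2 * h < 2 * z₀ + L + 1 ∧ 2 * z₀ + L + 1 ≤ 2 * h + 2 :=
    ⟨(2 * z₀ + L) / 2, by omega, by omega⟩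
  -- the place where the path reaches the axis
  have hsub : exitDir (lowerHalf L z₀) (entry 0 y₁) .north ⊆
      ⋃ x ∈ Finset.Icc (1 : ℤ) L,
        {ω | Joins ω (lowerHalf L z₀) (entry 0 y₁) ((x, h), .north)} := by
    rintro ω ⟨f, hf, hfD, hfd⟩
    have hf1 : f.1 ∈ lowerHalf L z₀ := by
      rcases hf.eq_or_source_mem with rfl | h
      · cases hfd
      · exact h
    obtain ⟨⟨x, z⟩, d⟩ := f
    simp only at hfd
    subst hfd
    simp only [tgt, hop, Finset.mem_coe, mem_lowerHalf] at hfD hf1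
    obtain rfl : z = h := by omega
    simp only [Set.mem_iUnion, Finset.mem_Icc]
    exact ⟨x, by omega, hf⟩
  obtain ⟨x, hx, hbx⟩ : ∃ x ∈ Finset.Icc (1 : ℤ) L, b / L ≤
      (cfgLaw m p ℤ).real {ω | Joins ω (lowerHalf L z₀) (entry 0 y₁) ((x, h), .north)} := by
    by_contra! hcon
    have h1 : b ≤ ∑ x ∈ Finset.Icc (1 : ℤ) L, (cfgLaw m p ℤ).real
        {ω | Joins ω (lowerHalf L z₀) (entry 0 y₁) ((x, h), .north)} :=
      hb.trans ((measureReal_mono hsub (measure_ne_top _ _)).trans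
        (measureReal_biUnion_finset_le _ _))
    have h2 := Finset.sum_lt_sum_of_nonempty (s := Finset.Icc (1 : ℤ) L)
      ⟨1, by rw [Finset.mem_Icc]; omega⟩ hcon
    rw [Finset.sum_const, Int.card_Icc, nsmul_eq_mul] at h2
    have h3 : ((((L : ℤ) + 1 - 1).toNat : ℕ) : ℝ) * (b / L) = b := by
      rw [add_sub_cancel_right, Int.toNat_natCast]
      field_simp
    linarith
  rw [Finset.mem_Icc] at hx
  have hbx' : b / L ≤ (cfgLaw m p ℤ).real {ω | Joins ω (upperHalf L z₀) (entry 0 y₂)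
      ((x, 2 * z₀ + L + 1 - h), .south)} := by
    let S := reflectSquare m hs hpar
    refine hbx.trans ((S.measureReal_joins_le (D' := upperHalf L z₀)
      (reflectSquare_injOn hs hpar _) ?_ _ _).trans (le_of_eq ?_))
    · intro v hv
      rw [reflectSquare_map, Finset.mem_coe, mem_upperHalf]
      rw [mem_lowerHalf] at hv
      simp only
      omega
    · have h1 : S.edge (entry 0 y₁) = entry 0 y₂ := by
        refine Prod.ext ?_ rfl
        change S.map (0, y₁) = (0, y₂)
        rw [reflectSquare_map, ← hs]
        simp
      have h2 : S.edge ((x, h), .north) = ((x, 2 * z₀ + L + 1 - h), .south) := by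
        refine Prod.ext ?_ rfl
        change S.map (x, h) = _
        rw [reflectSquare_map]
      rw [h1, h2]
  have hout1 : (entry 0 y₁).1 ∉ square L z₀ := by rw [mem_square]; simp [entry]
  have hout2 : (entry 0 y₂).1 ∉ square L z₀ := by rw [mem_square]; simp [entry]
  have hmid : (x, h + 1) ∈ square L z₀ := by
    rw [mem_square]
    simp only
    omega
  have hsp := splice (p := p) m (D := square L z₀) (e := entry 0 y₁) (e' := entry 0 y₂) hout1 hout2
    (by simp only [entry, ne_eq, Prod.mk.injEq]; omega)
    (fun hm => by
      rw [orient_entry, orient_entry]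
      exact intCast_eq_add_one_of_odd (hpar hm))
    (E := {ω | Joins ω (lowerHalf L z₀) (entry 0 y₁) ((x, h), .north)})
    (E' := {ω | Joins ω (upperHalf L z₀) (entry 0 y₂) ((x, 2 * z₀ + L + 1 - h), .south)})
    (fun ω ω' hω hmem => hmem.congr_visited hlow hω)
    (fun ω hω ω' hω' => by
      rw [Finset.not_disjoint_iff]
      refine ⟨(x, h + 1), Joins.tgt_mem_visited (hω.mono hlow) hmid, ?_⟩
      -- the paths meet on the axis, or right above it if the axis runs between two rows
      rcases hh2.lt_or_eq with hlt | heq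
      · have heq : 2 * z₀ + L + 1 - h = h + 1 := by omega
        have := Joins.source_mem_visited (D := square L z₀) (Joins.mono hω' hupp)
          (by rw [heq]; exact hmid) hout2
        rwa [heq] at this
      · have ht : tgt (((x, 2 * z₀ + L + 1 - h), .south) : (ℤ × ℤ) × Direction) = (x, h + 1) := by
          simp only [tgt, hop, Prod.mk.injEq, true_and]
          omega
        have := Joins.tgt_mem_visited (D := square L z₀) (Joins.mono hω' hupp)
          (by rw [ht]; exact hmid)
        rwa [ht] at this)
  rw [card_square] at hsp
  push_cast at hsp
  set P2 := (cfgLaw m p ℤ).real {ω | Joins ω (square L z₀) (entry 0 y₁) (rev (entry 0 y₂))}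
  have hbL : 0 ≤ b / L := by positivity
  have e1 : minProb p * (b / L * (b / L)) ≤ 3 * (L * L) * P2 :=
    (mul_le_mul_of_nonneg_left (mul_le_mul hbx hbx' hbL measureReal_nonneg) hc.le).trans hsp
  calc minProb p * b ^ 2 = (L : ℝ) ^ 2 * (minProb p * (b / L * (b / L))) := by
        field_simp
    _ ≤ (L : ℝ) ^ 2 * (3 * (L * L) * P2) := mul_le_mul_of_nonneg_left e1 (by positivity)
    _ = 3 * (L : ℝ) ^ 4 * P2 := by ring

/-- Light that comes in through `e` leaves `D`, but not in the direction west. -/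
def escapes {R : Type*} [CommRing R] (D : Set (ℤ × R)) (e : (ℤ × R) × Direction) :
    Set (ℤ × R → Site) :=
  {ω | ∃ f, Joins ω D e f ∧ tgt f ∉ D ∧ f.2 ≠ .west}

/-- If light from the upper entry is likely to leave the upper half of the square otherwise than to
the left, then the two entries are likely to be joined, either in the square or, on a cylinder of
circumference `2 * n`, around the back of the cylinder. -/
theorem le_measureReal_joins_of_escapes {L n : ℕ} {z₀ y₁ y₂ : ℤ}
    (hs : y₁ + y₂ = 2 * z₀ + L + 1) (h12 : y₁ < y₂) (hz : z₀ < y₁)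
    (hL : (L : ℤ) = 2 * n ∨ (L : ℤ) = 2 * n - 1)
    (hpar : m = .manhattan → Odd (y₁ + y₂)) {b : ℝ} (hb0 : 0 ≤ b)
    (hb : 3 * b ≤ (cfgLaw m p ℤ).real (escapes (upperHalf L z₀) (entry 0 y₂))) :
    minProb p ^ 2 * b ^ 3 ≤ 9 * (L : ℝ) ^ 4 * (cfgLaw m p ℤ).real
      {ω | Joins ω (square L z₀) (entry 0 y₁) (rev (entry 0 y₂))} ∨
    minProb p ^ 2 * b ^ 3 ≤ 9 * (L : ℝ) ^ 4 * (cfgLaw m p ℤ).real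
      {ω | Joins ω (square L (z₀ + n)) (entry 0 y₂) (rev (entry 0 (y₁ + 2 * n)))} := by
  have hc : 0 < minProb p := minProb_pos
  have hc1 : minProb p ≤ 1 := minProb_le_one
  have hb1 : b ≤ 1 := by
    have : (cfgLaw m p ℤ).real (escapes (upperHalf L z₀) (entry 0 y₂)) ≤ 1 := measureReal_le_one
    linarith
  have hweak : ∀ P : ℝ, 0 ≤ P → minProb p * b ^ 2 ≤ 3 * (L : ℝ) ^ 4 * P →
      minProb p ^ 2 * b ^ 3 ≤ 9 * (L : ℝ) ^ 4 * P := by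
    intro P hP h
    have h1 : minProb p ^ 2 * b ^ 3 = minProb p * b * (minProb p * b ^ 2) := by ring
    have h2 : minProb p * b ≤ 1 := mul_le_one₀ hc1 hb0 hb1
    have h3 : 0 ≤ minProb p * b ^ 2 := by positivity
    have h4 : 0 ≤ (L : ℝ) ^ 4 * P := by positivity
    rw [h1]
    nlinarith
  have hsub : escapes (upperHalf L z₀) (entry 0 y₂) ⊆
      (exitDir (upperHalf L z₀) (entry 0 y₂) .east ∪
        exitDir (upperHalf L z₀) (entry 0 y₂) .north) ∪
        exitDir (upperHalf L z₀) (entry 0 y₂) .south := by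
    rintro ω ⟨f, hf, hfD, hfd⟩
    rcases hd : f.2 with _ | _ | _ | _
    · exact Or.inl (Or.inl ⟨f, hf, hfD, hd⟩)
    · exact Or.inl (Or.inr ⟨f, hf, hfD, hd⟩)
    · exact absurd hd hfd
    · exact Or.inr ⟨f, hf, hfD, hd⟩
  have hsum : 3 * b ≤ (cfgLaw m p ℤ).real (exitDir (upperHalf L z₀) (entry 0 y₂) .east) +
      (cfgLaw m p ℤ).real (exitDir (upperHalf L z₀) (entry 0 y₂) .north) +
      (cfgLaw m p ℤ).real (exitDir (upperHalf L z₀) (entry 0 y₂) .south) :=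
    hb.trans ((measureReal_mono hsub (measure_ne_top _ _)).trans ((measureReal_union_le _ _).trans
      (add_le_add_left (measureReal_union_le _ _) _)))
  by_cases hE : b ≤ (cfgLaw m p ℤ).real (exitDir (upperHalf L z₀) (entry 0 y₂) .east)
  · left
    have h1 := le_measureReal_joins_of_exit_east (m := m) (p := p) hs h12 hz hpar hb0
      (hE.trans (measureReal_mono (by
        rintro ω ⟨f, hf, hfD, hfd⟩
        refine ⟨f, hf.mono (by rw [Finset.coe_subset]; exact Finset.filter_subset _ _), ?_, hfd⟩
        rcases hf.eq_or_source_mem with rfl | hf1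
        · intro h
          apply hfD
          simp only [tgt, hop, entry, Finset.mem_coe, mem_square, mem_upperHalf] at h ⊢
          omega
        · obtain ⟨⟨x, z⟩, d⟩ := f
          simp only at hfd
          subst hfd
          simp only [tgt, hop, Finset.mem_coe, mem_square, mem_upperHalf] at hf1 hfD ⊢
          omega)))
    refine h1.trans (le_of_eq ?_)
    ring
  by_cases hN : b ≤ (cfgLaw m p ℤ).real (exitDir (upperHalf L z₀) (entry 0 y₂) .north)
  · right
    refine hweak _ measureReal_nonneg ?_
    have hset : upperHalf L z₀ = lowerHalf L (z₀ + n) := by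
      ext v
      rw [mem_upperHalf, mem_lowerHalf]
      omega
    rw [hset] at hN
    refine le_measureReal_joins_of_exit_north (m := m) (p := p) (by omega) (by omega) (by omega)
      (fun hm => ?_) hb0 hN
    have := hpar hm
    rw [Int.odd_iff] at this ⊢
    omega
  · left
    refine hweak _ measureReal_nonneg ?_
    refine le_measureReal_joins_of_exit_north (m := m) (p := p) hs h12 hz hpar hb0 ?_
    push Not at hE hN
    have hS : b ≤ (cfgLaw m p ℤ).real (exitDir (upperHalf L z₀) (entry 0 y₂) .south) := by
      linarith
    let S := reflectSquare m hs hpar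
    refine hS.trans ((S.measureReal_exitDir_le (D' := lowerHalf L z₀)
      (reflectSquare_injOn hs hpar _) ?_ _ _).trans (le_of_eq ?_))
    · intro v
      rw [reflectSquare_map, Finset.mem_coe, mem_lowerHalf, mem_upperHalf]
      simp only
      omega
    · have h1 : S.edge (entry 0 y₂) = entry 0 y₁ := by
        refine Prod.ext ?_ rfl
        change S.map (0, y₂) = (0, y₁)
        rw [reflectSquare_map, ← hs]
        simp
      rw [h1]
      rfl

end SquareJoin

/-! ### Crossings of the sections of a cylinder -/

section Strip

/-- The section `{t + 1, …, t + k} × R` of the cylinder. -/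
def strip (R : Type*) [Fintype R] (t : ℤ) (k : ℕ) : Finset (ℤ × R) :=
  Finset.Icc (t + 1) (t + k) ×ˢ Finset.univ

theorem mem_strip {R : Type*} [Fintype R] {t : ℤ} {k : ℕ} {v : ℤ × R} :
    v ∈ strip R t k ↔ t + 1 ≤ v.1 ∧ v.1 ≤ t + k := by
  rw [strip, Finset.mem_product, Finset.mem_Icc]
  simp

theorem strip_subset_left {R : Type*} [Fintype R] (t : ℤ) (k k' : ℕ) :
    (strip R t k : Set (ℤ × R)) ⊆ strip R t (k + k') := by
  intro v hv
  rw [Finset.mem_coe, mem_strip] at hv ⊢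
  push_cast
  omega

theorem strip_subset_right {R : Type*} [Fintype R] (t : ℤ) (k k' : ℕ) :
    (strip R (t + k) k' : Set (ℤ × R)) ⊆ strip R t (k + k') := by
  intro v hv
  rw [Finset.mem_coe, mem_strip] at hv ⊢
  push_cast
  omega

variable {R : Type*} [CommRing R]

theorem rev_entry_ne (t t' : ℤ) (y y' : R) : rev (entry t y) ≠ entry t' y' := by
  intro h
  cases congrArg Prod.snd h

theorem entry_injective (t : ℤ) : Function.Injective (entry (R := R) t) := by
  intro y y' h
  simpa [entry] using h

variable [Fintype R]

/-- The heights at which light that comes from the left crosses the section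
`{t + 1, …, t + k} × R`. -/
def crossers (ω : ℤ × R → Site) (t : ℤ) (k : ℕ) : Set R :=
  {y | ∃ r, Joins ω (strip R t k) (entry t y) (entry (t + k) r)}

theorem determined_crossers (t : ℤ) (k : ℕ) (P : Set R → Prop) :
    Determined {ω | P (crossers ω t k)} (strip R t k : Set (ℤ × R)) := by
  intro ω ω' hω h
  have : crossers ω' t k = crossers ω t k := by
    ext y
    exact exists_congr fun r => ⟨fun h => h.congr fun v hv => (hω v hv).symm, fun h => h.congr hω⟩
  rw [Set.mem_ofPred_eq, this]
  exact h

theorem entry_notMem_strip (t : ℤ) (k : ℕ) (y : R) :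
    (entry t y).1 ∉ (strip R t k : Set (ℤ × R)) := by
  rw [Finset.mem_coe, mem_strip]
  simp [entry]

theorem tgt_rev_entry_notMem_strip (t : ℤ) (k : ℕ) (y : R) :
    tgt (rev (entry t y)) ∉ (strip R t k : Set (ℤ × R)) := by
  rw [tgt_rev]
  exact entry_notMem_strip t k y

theorem tgt_entry_notMem_strip (t : ℤ) (k : ℕ) (y : R) :
    tgt (entry (t + k) y) ∉ (strip R t k : Set (ℤ × R)) := by
  rw [Finset.mem_coe, mem_strip]
  simp only [entry, tgt, hop]
  omega

/-- Light that comes from the left either crosses the section or comes back. -/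
theorem mem_crossers_or_exists (ω : ℤ × R → Site) (t : ℤ) (k : ℕ) (y : R) :
    y ∈ crossers ω t k ∨ ∃ y', Joins ω (strip R t k) (entry t y) (rev (entry t y')) := by
  obtain ⟨f, hf, hfD⟩ := exists_exit ω (strip R t k).finite_toSet (entry_notMem_strip t k y)
  rcases hf.eq_or_source_mem with rfl | hf1
  · left
    rw [Finset.mem_coe, mem_strip] at hfD
    simp only [entry, tgt, hop] at hfD
    obtain rfl : k = 0 := by omega
    exact ⟨y, by simpa using hf⟩
  · obtain ⟨⟨x, z⟩, d⟩ := f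
    rw [Finset.mem_coe, mem_strip] at hf1 hfD
    cases d <;> simp only [tgt, hop] at hfD hf1
    · left
      obtain rfl : x = t + k := by omega
      exact ⟨z, hf⟩
    · omega
    · right
      obtain rfl : x = t + 1 := by omega
      exact ⟨z, hf⟩
    · omega

theorem Joins.notMem_crossers {ω : ℤ × R → Site} {t : ℤ} {k : ℕ} {y y' : R}
    (h : Joins ω (strip R t k) (entry t y) (rev (entry t y'))) : y ∉ crossers ω t k := by
  rintro ⟨r, hr⟩
  exact rev_entry_ne _ _ _ _ (h.exit_unique hr (tgt_rev_entry_notMem_strip _ _ _)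
    (tgt_entry_notMem_strip _ _ _))

theorem crossers_subset (ω : ℤ × R → Site) (t : ℤ) (k k' : ℕ) :
    crossers ω t (k + k') ⊆ crossers ω t k := by
  intro y hy
  rcases mem_crossers_or_exists ω t k y with h | ⟨y', h⟩
  · exact h
  · exact absurd hy (h.mono (strip_subset_left t k k')).notMem_crossers

/-- If two paths that cross a section are joined to each other in the next section, then they do
not cross both sections. -/
theorem notMem_crossers_of_joins {ω : ℤ × R → Site} {t : ℤ} {k k' : ℕ} {y₁ y₂ r₁ r₂ : R}
    (h1 : Joins ω (strip R t k) (entry t y₁) (entry (t + k) r₁))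
    (h2 : Joins ω (strip R t k) (entry t y₂) (entry (t + k) r₂))
    (h : Joins ω (strip R (t + k) k') (entry (t + k) r₁) (rev (entry (t + k) r₂))) :
    y₁ ∉ crossers ω t (k + k') :=
  Joins.notMem_crossers (((h1.mono (strip_subset_left t k k')).trans
    (h.mono (strip_subset_right t k k'))).trans (h2.mono (strip_subset_left t k k')).reverse)

theorem exit_row_ne {ω : ℤ × R → Site} {t : ℤ} {k : ℕ} {y₁ y₂ r₁ r₂ : R}
    (h1 : Joins ω (strip R t k) (entry t y₁) (entry (t + k) r₁))
    (h2 : Joins ω (strip R t k) (entry t y₂) (entry (t + k) r₂)) (hy : y₁ ≠ y₂) : r₁ ≠ r₂ := by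
  rintro rfl
  exact hy (entry_injective t (rev_injective (h1.reverse.exit_unique h2.reverse
    (tgt_rev_entry_notMem_strip _ _ _) (tgt_rev_entry_notMem_strip _ _ _))))

/-- The paths that do not cross the section pair up the heights at which they come in. -/
theorem sum_notMem_crossers_eq_zero {A : Type*} [AddCommMonoid A] (ω : ℤ × R → Site) (t : ℤ)
    (k : ℕ) (F : Finset R) (hF : ∀ y, y ∈ F ↔ y ∉ crossers ω t k) (χ : R → A)
    (hχ : ∀ y y', Joins ω (strip R t k) (entry t y) (rev (entry t y')) → χ y + χ y' = 0) :
    ∑ y ∈ F, χ y = 0 := by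
  classical
  have hex : ∀ y ∈ F, ∃ y', Joins ω (strip R t k) (entry t y) (rev (entry t y')) := fun y hy =>
    (mem_crossers_or_exists ω t k y).resolve_left ((hF y).mp hy)
  choose! g hg using hex
  have hsymm : ∀ y ∈ F, Joins ω (strip R t k) (entry t (g y)) (rev (entry t y)) := fun y hy => by
    have := (hg y hy).reverse
    rwa [rev_rev] at this
  have hmem : ∀ y ∈ F, g y ∈ F := fun y hy => (hF _).mpr (hsymm y hy).notMem_crossers
  refine Finset.sum_involution (fun y _ => g y) (fun y hy => hχ _ _ (hg y hy)) (fun y hy _ h => ?_)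
    hmem fun y hy => ?_
  · have := hg y hy
    rw [h] at this
    exact this.ne_rev
  · exact entry_injective t (rev_injective ((hg _ (hmem y hy)).exit_unique (hsymm y hy)
      (tgt_rev_entry_notMem_strip _ _ _) (tgt_rev_entry_notMem_strip _ _ _)))

/-- If no light crosses a section, then light that starts on the left of it stays on the left of
its right side. -/
theorem source_le_of_crossers_eq_empty {ω : ℤ × R → Site} {t : ℤ} {B : ℕ}
    (h : crossers ω t B = ∅) (k : ℕ) {e : (ℤ × R) × Direction} (he : e.1.1 ≤ t) :
    ((step ω)^[k] e).1.1 ≤ t + B := by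
  induction k using Nat.strong_induction_on generalizing e with
  | _ k ih =>
    rcases Nat.eq_zero_or_pos k with rfl | hk
    · change e.1.1 ≤ _
      omega
    obtain ⟨k, rfl⟩ := Nat.exists_eq_add_of_le' hk
    by_cases hte : (tgt e).1 ≤ t
    · rw [Function.iterate_add_apply]
      exact ih k (by omega) hte
    · obtain ⟨⟨x, y⟩, d⟩ := e
      cases d <;> simp only [tgt, hop] at he hte <;> try omega
      obtain rfl : x = t := by omega
      have hy : y ∉ crossers ω x B := by rw [h]; exact Set.notMem_empty y
      obtain ⟨y', j, hj, hjD⟩ := (mem_crossers_or_exists ω x B y).resolve_left hy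
      change ((step ω)^[k + 1] (entry x y)).1.1 ≤ _
      rcases Nat.lt_or_ge k j with hkj | hkj
      · have := hjD k hkj
        rw [Finset.mem_coe, mem_strip] at this
        rw [Function.iterate_succ_apply']
        exact this.2
      · have hsplit : (step ω)^[k + 1] (entry x y) =
            (step ω)^[k - j] (step ω (rev (entry x y'))) := by
          rw [← hj, ← Function.iterate_succ_apply' (step ω) j, ← Function.iterate_add_apply]
          rw [show k - j + j.succ = k + 1 by omega]
        rw [hsplit]
        refine ih (k - j) (by omega) (le_of_eq ?_)
        change (tgt (rev (entry x y'))).1 = x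
        rw [tgt_rev]
        rfl

/-- If no light crosses a section, then light that starts on the right of it stays on the right of
its left side. -/
theorem le_source_of_crossers_eq_empty {ω : ℤ × R → Site} {t : ℤ} {B : ℕ}
    (h : crossers ω t B = ∅) (k : ℕ) {e : (ℤ × R) × Direction} (he : t + B + 1 ≤ e.1.1) :
    t + 1 ≤ ((step ω)^[k] e).1.1 := by
  cases k with
  | zero => change _ ≤ e.1.1; omega
  | succ k =>
    by_contra! hlt
    rw [Function.iterate_succ_apply'] at hlt
    have hj : Joins ω Set.univ e ((step ω)^[k] e) := ⟨k, rfl, fun _ _ => Set.mem_univ _⟩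
    obtain ⟨l, hl, -⟩ := hj.reverse
    have h1 := source_le_of_crossers_eq_empty h (l + 1) (e := rev ((step ω)^[k] e)) (by
      change (tgt ((step ω)^[k] e)).1 ≤ t
      change (tgt ((step ω)^[k] e)).1 < t + 1 at hlt
      omega)
    rw [Function.iterate_succ_apply', hl] at h1
    change (tgt (rev e)).1 ≤ _ at h1
    rw [tgt_rev] at h1
    omega

end Strip

section Cylinder

theorem step_eq_next {n : ℕ} (ω : Config n) (e : Edge n) : step ω e = ω.next e := by
  obtain ⟨v, d⟩ := e
  cases d <;> rfl

theorem exists_iterate_of_mem_vertexSet {n : ℕ} {ω : Config n} {L : List (Edge n)}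
    (hL : IsTrajectory ω L) : ∃ e : Edge n, ∀ v ∈ vertexSet L, ∃ k, ((step ω)^[k] e).1 = v := by
  obtain ⟨hne, hchain⟩ := hL
  induction L with
  | nil => exact absurd rfl hne
  | cons a l ih =>
    refine ⟨a, ?_⟩
    have htgt : ∀ e : Edge n, Edge.target e = tgt e := by
      rintro ⟨v, d⟩
      cases d <;> rfl
    suffices ∀ e ∈ a :: l, ∃ k, (step ω)^[k] a = e by
      rintro v ⟨e, he, hv⟩
      obtain ⟨k, rfl⟩ := this e he
      rcases hv with rfl | rfl
      · exact ⟨k, rfl⟩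
      · refine ⟨k + 1, ?_⟩
        rw [Function.iterate_succ_apply', htgt]
        rfl
    clear ih hne
    induction l generalizing a with
    | nil =>
      intro e he
      rw [List.mem_singleton] at he
      exact ⟨0, he.symm⟩
    | cons b l ih =>
      intro e he
      rw [List.isChain_cons_cons] at hchain
      rcases List.mem_cons.mp he with rfl | he
      · exact ⟨0, rfl⟩
      · obtain ⟨k, rfl⟩ := ih b hchain.2 e he
        refine ⟨k + 1, ?_⟩
        rw [Function.iterate_succ_apply, step_eq_next, ← hchain.1]

variable {n : ℕ} [NeZero (2 * n)]

theorem mem_localizationEvent {ω : Config n} {M B : ℕ} {t t' : ℤ}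
    (h : crossers (R := ZMod (2 * n)) ω t B = ∅) (ht : 0 ≤ t) (htM : t + B ≤ M)
    (h' : crossers (R := ZMod (2 * n)) ω t' B = ∅) (ht' : t' + B < 0) (htM' : -(M : ℤ) ≤ t') :
    ω ∈ localizationEvent n M := by
  intro L hL ⟨v, hv, hv0⟩ u hu
  obtain ⟨e, he⟩ := exists_iterate_of_mem_vertexSet hL
  obtain ⟨i, rfl⟩ := he v hv
  obtain ⟨j, rfl⟩ := he u hu
  rcases Nat.le_total i j with hij | hij
  · obtain ⟨k, rfl⟩ := Nat.exists_eq_add_of_le' hij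
    rw [Function.iterate_add_apply]
    have h1 := source_le_of_crossers_eq_empty h k (e := (step ω)^[i] e) (by omega)
    have h2 := le_source_of_crossers_eq_empty h' k (e := (step ω)^[i] e) (by omega)
    omega
  · obtain ⟨k, rfl⟩ := Nat.exists_eq_add_of_le' hij
    rw [Function.iterate_add_apply] at hv0
    constructor
    · by_contra! hlt
      have := source_le_of_crossers_eq_empty h' k (e := (step ω)^[j] e) (by omega)
      omega
    · by_contra! hlt
      have := le_source_of_crossers_eq_empty h k (e := (step ω)^[j] e) (by omega)
      omega

theorem sum_sign_par_eq_zero :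
    ∑ y : ZMod (2 * n), (if par y = (0 : ZMod 2) then (1 : ℤ) else -1) = 0 := by
  have h := Equiv.sum_comp (Equiv.addRight (1 : ZMod (2 * n)))
    fun y => if par y = (0 : ZMod 2) then (1 : ℤ) else -1
  have h1 : ∀ y : ZMod (2 * n), (if par (Equiv.addRight 1 y) = (0 : ZMod 2) then (1 : ℤ) else -1) =
      -(if par y = (0 : ZMod 2) then (1 : ℤ) else -1) := by
    intro y
    rw [Equiv.coe_addRight, map_add, map_one]
    generalize par y = a
    revert a
    decide
  simp only [h1, Finset.sum_neg_distrib] at h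
  omega

theorem Joins.orient_eq {R : Type*} [CommRing R] [RowParity R] {ω : ℤ × R → Site}
    {D : Set (ℤ × R)} {e f : (ℤ × R) × Direction} (h : Joins ω D e f)
    (hω : ∀ v, Allowed .manhattan v (ω v)) : orient f = orient e := by
  obtain ⟨k, rfl, -⟩ := h
  exact orient_iterate hω e k

/-- As the circumference is even, the light paths that cross a section come in pairs. In the
Manhattan model, the paths of a pair run in opposite directions. -/
theorem exists_pair_of_crossers_nonempty {m : Model} {ω : ℤ × ZMod (2 * n) → Site}
    (hω : ∀ v, Allowed m v (ω v)) {t : ℤ} {k : ℕ} (hne : (crossers ω t k).Nonempty) :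
    ∃ y₁ y₂ r₁ r₂, Joins ω (strip (ZMod (2 * n)) t k) (entry t y₁) (entry (t + k) r₁) ∧
      Joins ω (strip (ZMod (2 * n)) t k) (entry t y₂) (entry (t + k) r₂) ∧ r₁ ≠ r₂ ∧
      (m = .manhattan → par r₂ = par r₁ + 1) := by
  classical
  suffices ∃ y₁ ∈ crossers ω t k, ∃ y₂ ∈ crossers ω t k, y₁ ≠ y₂ ∧
      (m = .manhattan → par y₂ = par y₁ + 1) by
    obtain ⟨y₁, ⟨r₁, h1⟩, y₂, ⟨r₂, h2⟩, hy, hpar⟩ := this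
    refine ⟨y₁, y₂, r₁, r₂, h1, h2, exit_row_ne h1 h2 hy, fun hm => ?_⟩
    subst hm
    have e1 := h1.orient_eq hω
    have e2 := h2.orient_eq hω
    rw [orient_entry, orient_entry] at e1 e2
    rw [e1, e2, hpar rfl]
  obtain ⟨y₁, hy₁⟩ := hne
  let F : Finset (ZMod (2 * n)) := Finset.univ.filter fun y => y ∉ crossers ω t k
  have hF : ∀ y, y ∈ F ↔ y ∉ crossers ω t k := by simp [F]
  by_contra! hcon
  cases m
  · -- the number of heights is even
    have h0 := sum_notMem_crossers_eq_zero ω t k F hF (fun _ => (1 : ZMod 2))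
      fun _ _ _ => by decide
    have hFc : Fᶜ = {y₁} := by
      ext y
      rw [Finset.mem_compl, hF, not_not, Finset.mem_singleton]
      constructor
      · intro hy
        by_contra hne
        exact absurd (hcon y₁ hy₁ y hy fun h => hne h.symm).1 (by simp)
      · rintro rfl
        exact hy₁
    have h1 := Finset.sum_add_sum_compl F fun _ => (1 : ZMod 2)
    rw [h0, hFc, Finset.sum_singleton, zero_add, Finset.sum_const, Finset.card_univ, ZMod.card,
      nsmul_one, Nat.cast_mul] at h1
    have h2 : ((2 : ℕ) : ZMod 2) = 0 := by decide
    rw [h2, zero_mul] at h1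
    exact one_ne_zero h1
  · -- there are as many even heights as odd ones
    have h0 := sum_notMem_crossers_eq_zero ω t k F hF
      (fun y => if par y = (0 : ZMod 2) then (1 : ℤ) else -1) fun y y' hj => by
        have := hj.orient_eq hω
        rw [orient_rev, orient_entry, orient_entry] at this
        rw [← this]
        generalize par y' = a
        revert a
        decide
    have h1 := Finset.sum_add_sum_compl F fun y =>
      if par y = (0 : ZMod 2) then (1 : ℤ) else -1
    rw [h0, zero_add, sum_sign_par_eq_zero] at h1
    have hsame : ∀ y ∈ Fᶜ, par y = (par y₁ : ZMod 2) := by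
      intro y hy
      rw [Finset.mem_compl, hF, not_not] at hy
      by_contra hpar
      refine (hcon y₁ hy₁ y hy fun h => hpar (by rw [h])).2 ?_
      revert hpar
      generalize par y = a
      generalize par y₁ = b
      revert a b
      decide
    rw [Finset.sum_congr rfl fun y hy => by rw [hsame y hy], Finset.sum_const, nsmul_eq_mul,
      mul_eq_zero] at h1
    rcases h1 with h1 | h1
    · have : Fᶜ = ∅ := by
        rw [← Finset.card_eq_zero]
        exact_mod_cast h1
      have hmem : y₁ ∈ Fᶜ := by
        rw [Finset.mem_compl, hF, not_not]
        exact hy₁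
      rw [this] at hmem
      exact absurd hmem (Finset.notMem_empty _)
    · split_ifs at h1; omega

end Cylinder

/-! ### Joining two entries of a section of the cylinder -/

section Transfer

theorem eq_of_intCast_eq {n : ℕ} {z z' : ℤ} (h : (z : ZMod (2 * n)) = z') (h1 : z - z' < 2 * n)
    (h2 : z' - z < 2 * n) : z = z' := by
  rw [ZMod.intCast_eq_intCast_iff_dvd_sub] at h
  push_cast at h
  have := Int.eq_zero_of_abs_lt_dvd h (abs_lt.mpr ⟨by omega, by omega⟩)
  omega

theorem even_intCast {t : ℤ} (h : Even t) : (t : ZMod 2) = 0 :=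
  (ZMod.intCast_eq_zero_iff_even).mpr h

variable {n : ℕ} [NeZero (2 * n)] {m : Model} {p : ℝ} [hp : Fact (0 < p ∧ p < 1)]

/-- Two entries are joined in a section of the cylinder if they are joined in a square of the plane
that covers a part of the section. -/
theorem measureReal_joins_square_le {L : ℕ} (z₀ : ℤ) {t : ℤ} (hL : L ≤ 2 * n)
    (ht : m = .manhattan → Even t) (y₁ y₂ : ℤ) :
    (cfgLaw m p ℤ).real {ω | Joins ω (square L z₀) (entry 0 y₁) (rev (entry 0 y₂))} ≤
      (cfgLaw m p (ZMod (2 * n))).real {ω | Joins ω (strip (ZMod (2 * n)) t (2 * n))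
        (entry t (y₁ : ZMod (2 * n))) (rev (entry t (y₂ : ZMod (2 * n))))} := by
  let S : Symm m ℤ (ZMod (2 * n)) := Symm.shift m _ t 0 fun hm => by
    rw [even_intCast (ht hm)]; simp
  refine (S.measureReal_joins_le (D' := strip (ZMod (2 * n)) t (2 * n)) ?_ ?_ _ _).trans
    (le_of_eq ?_)
  · rintro ⟨x, z⟩ hv ⟨x', z'⟩ hv' h
    rw [Finset.mem_coe, mem_square] at hv hv'
    simp only [S, Symm.shift, Prod.mk.injEq, add_zero] at h hv hv'
    have := eq_of_intCast_eq h.2 (by omega) (by omega)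
    ext <;> simp only <;> omega
  · intro v hv
    rw [mem_square] at hv
    rw [Finset.mem_coe, mem_strip]
    simp only [S, Symm.shift]
    push_cast
    omega
  · have h1 : ∀ y : ℤ, S.edge (entry 0 y) = entry t (y : ZMod (2 * n)) := by
      intro y
      simp [Symm.edge, S, Symm.shift, entry]
    have h2 : ∀ y : ℤ, S.edge (rev (entry 0 y)) = rev (entry t (y : ZMod (2 * n))) := by
      intro y
      simp [Symm.edge, S, Symm.shift, entry, rev, tgt, hop, add_comm]
    rw [h1, h2]

/-- Light that crosses a section of the cylinder escapes from the right side, the top or the bottom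
of every box of the plane that covers a part of the section. -/
theorem measureReal_mem_crossers_le {L : ℕ} {z₀ t y : ℤ} (hL : L ≤ 2 * n)
    (ht : m = .manhattan → Even t) (y₀ : ZMod (2 * n)) :
    (cfgLaw m p (ZMod (2 * n))).real {ω | y₀ ∈ crossers ω t (2 * n)} ≤
      (cfgLaw m p ℤ).real (escapes (upperHalf L z₀) (entry 0 y)) := by
  obtain ⟨w, rfl⟩ := ZMod.intCast_surjective y₀
  -- a translation or a reflection maps the entry at `y` to the entry at `w`
  obtain ⟨S, hSy, hScol, hSinj, hSeast, hSwest⟩ : ∃ S : Symm m ℤ (ZMod (2 * n)),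
      S.map (0, y) = (t, (w : ZMod (2 * n))) ∧ (∀ v, (S.map v).1 = v.1 + t) ∧
      Set.InjOn S.map (upperHalf L z₀) ∧ S.dir .east = .east ∧ S.dir .west = .west := by
    by_cases hpar : m = .manhattan → Even (w - y)
    · refine ⟨Symm.shift m _ t (w - y) fun hm => ?_, ?_, fun v => rfl, ?_, rfl, rfl⟩
      · rw [even_intCast (ht hm), even_intCast (hpar hm), add_zero]
      · simp [Symm.shift]
      · rintro ⟨x, z⟩ hv ⟨x', z'⟩ hv' h
        rw [Finset.mem_coe, mem_upperHalf] at hv hv'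
        simp only [Symm.shift, Prod.mk.injEq] at h hv hv'
        have := eq_of_intCast_eq h.2 (by omega) (by omega)
        ext <;> simp only <;> omega
    · refine ⟨Symm.flip m _ t (w + y) fun hm => ?_, ?_, fun v => rfl, ?_, rfl, rfl⟩
      · have h1 : Odd (y + w) := by
          rw [Classical.not_imp, Int.even_sub] at hpar
          rw [← Int.not_even_iff_odd, Int.even_add]
          tauto
        rw [even_intCast (ht hm), Int.cast_add, intCast_eq_add_one_of_odd h1]
        have := CharTwo.add_self_eq_zero (y : ZMod 2)
        linear_combination this
      · simp [Symm.flip]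
      · rintro ⟨x, z⟩ hv ⟨x', z'⟩ hv' h
        rw [Finset.mem_coe, mem_upperHalf] at hv hv'
        simp only [Symm.flip, Prod.mk.injEq] at h hv hv'
        have := eq_of_intCast_eq h.2 (by omega) (by omega)
        ext <;> simp only <;> omega
  have hdet : Determined (escapes (upperHalf L z₀) (entry 0 y)) (upperHalf L z₀) := by
    rintro ω ω' hω ⟨f, hf, h⟩
    exact ⟨f, hf.congr hω, h⟩
  rw [← S.measureReal_pull hSinj hdet]
  refine measureReal_mono ?_
  rintro ω ⟨r, hr⟩
  have hout : (entry 0 y).1 ∉ (upperHalf L z₀ : Set (ℤ × ℤ)) := by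
    rw [Finset.mem_coe, mem_upperHalf]; simp [entry]
  obtain ⟨f, hf, hfD⟩ := exists_exit (S.pull ω) (upperHalf L z₀).finite_toSet hout
  refine ⟨f, hf, hfD, fun hfd => ?_⟩
  have hSf := S.joins (D' := strip (ZMod (2 * n)) t (2 * n)) hf fun v hv => by
    rw [Finset.mem_coe, mem_upperHalf] at hv
    rw [Finset.mem_coe, mem_strip, hScol]
    push_cast
    omega
  have hSe : S.edge (entry 0 y) = entry t (w : ZMod (2 * n)) := Prod.ext hSy hSeast
  rw [hSe] at hSf
  have htgt : tgt (S.edge f) ∉ (strip (ZMod (2 * n)) t (2 * n) : Set (ℤ × ZMod (2 * n))) := by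
    rcases hf.eq_or_source_mem with rfl | hf1
    · cases hfd
    · obtain ⟨⟨x, z⟩, d⟩ := f
      simp only at hfd
      subst hfd
      rw [S.tgt_edge, Finset.mem_coe, mem_strip, hScol]
      simp only [tgt, hop, Finset.mem_coe, mem_upperHalf] at hf1 hfD ⊢
      omega
  have heq := hSf.exit_unique hr htgt (tgt_entry_notMem_strip _ _ _)
  have hd := congrArg Prod.snd heq
  change S.dir f.2 = .east at hd
  rw [hfd, hSwest] at hd
  cases hd

/-- If light from one entry of a section of length `2 * n` is likely to cross the section, then any
two entries are joined in the section with a probability that is not much smaller. -/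
theorem le_measureReal_joins_strip {b : ℝ} (hb0 : 0 ≤ b) {t₀ : ℤ}
    (ht₀ : m = .manhattan → Even t₀) {y₀ : ZMod (2 * n)}
    (hb : 3 * b ≤ (cfgLaw m p (ZMod (2 * n))).real {ω | y₀ ∈ crossers ω t₀ (2 * n)}) {t : ℤ}
    (ht : m = .manhattan → Even t) {r₁ r₂ : ZMod (2 * n)} (hr : r₁ ≠ r₂)
    (hpar : m = .manhattan → par r₂ = par r₁ + 1) :
    minProb p ^ 2 * b ^ 3 ≤ 9 * (2 * n : ℝ) ^ 4 * (cfgLaw m p (ZMod (2 * n))).real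
      {ω | Joins ω (strip (ZMod (2 * n)) t (2 * n)) (entry t r₁) (rev (entry t r₂))} := by
  have hsymm : ∀ r₁ r₂ : ZMod (2 * n), (cfgLaw m p (ZMod (2 * n))).real
      {ω | Joins ω (strip (ZMod (2 * n)) t (2 * n)) (entry t r₁) (rev (entry t r₂))} ≤
      (cfgLaw m p (ZMod (2 * n))).real
        {ω | Joins ω (strip (ZMod (2 * n)) t (2 * n)) (entry t r₂) (rev (entry t r₁))} := by
    intro r₁ r₂
    refine measureReal_mono fun ω hω => ?_
    have := Joins.reverse hω
    rwa [rev_rev] at this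
  -- representatives of the two heights
  obtain ⟨y₁, rfl, hy₁0, hy₁n⟩ : ∃ y : ℤ, (y : ZMod (2 * n)) = r₁ ∧ 0 ≤ y ∧ y < 2 * n :=
    ⟨r₁.val, by simp, by omega, by exact_mod_cast ZMod.val_lt r₁⟩
  obtain ⟨y₂, rfl, hy₂0, hy₂n⟩ : ∃ y : ℤ, (y : ZMod (2 * n)) = r₂ ∧ 0 ≤ y ∧ y < 2 * n :=
    ⟨r₂.val, by simp, by omega, by exact_mod_cast ZMod.val_lt r₂⟩
  have hodd : m = .manhattan → Odd (y₁ + y₂) := fun hm => by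
    have := hpar hm
    rw [map_intCast, map_intCast] at this
    rw [← Int.not_even_iff_odd, ← ZMod.intCast_eq_zero_iff_even, Int.cast_add, this, ← add_assoc,
      CharTwo.add_self_eq_zero, zero_add]
    exact one_ne_zero
  clear hpar
  wlog h12 : y₁ < y₂ generalizing y₁ y₂
  · refine (this (y₁ := y₂) (y₂ := y₁) (hr := hr.symm) (hy₁0 := hy₂0) (hy₁n := hy₂n)
      (hy₂0 := hy₁0) (hy₂n := hy₁n) (hodd := fun hm => by rw [add_comm]; exact hodd hm)
      (h12 := ?_)).trans (mul_le_mul_of_nonneg_left (hsymm _ _) (by positivity))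
    rcases lt_trichotomy y₁ y₂ with h | h | h
    · exact absurd h h12
    · exact absurd (by rw [h]) hr
    · exact h
  obtain ⟨L, z₀, hs, hL⟩ : ∃ (L : ℕ) (z₀ : ℤ), y₁ + y₂ = 2 * z₀ + L + 1 ∧
      ((L : ℤ) = 2 * n ∨ (L : ℤ) = 2 * n - 1) := by
    rcases Int.even_or_odd' (y₁ + y₂) with ⟨c, hc | hc⟩
    · exact ⟨2 * n - 1, c - n, by omega, by omega⟩
    · exact ⟨2 * n, c - n, by omega, by omega⟩
  have hLn : L ≤ 2 * n := by omega
  have hmain := le_measureReal_joins_of_escapes (m := m) (p := p) hs h12 (by omega) hL hodd hb0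
    (hb.trans (measureReal_mem_crossers_le hLn ht₀ y₀))
  have hLn' : 9 * (L : ℝ) ^ 4 ≤ 9 * (2 * n : ℝ) ^ 4 := by
    have : (L : ℝ) ≤ 2 * n := by exact_mod_cast hLn
    gcongr
  rcases hmain with h | h
  · exact h.trans (mul_le_mul hLn' (measureReal_joins_square_le z₀ hLn ht y₁ y₂) measureReal_nonneg
      (by positivity))
  · refine h.trans (mul_le_mul hLn' ?_ measureReal_nonneg (by positivity))
    refine (measureReal_joins_square_le (z₀ + n) hLn ht y₂ (y₁ + 2 * n)).trans ?_
    have hwrap : ((y₁ + 2 * n : ℤ) : ZMod (2 * n)) = y₁ := by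
      have := ZMod.natCast_self (2 * n)
      push_cast at this ⊢
      rw [this, add_zero]
    rw [hwrap]
    exact hsymm _ _

end Transfer

/-! ### Decay of the number of crossings -/

section Decay

variable {n : ℕ} [NeZero (2 * n)] {m : Model} {p : ℝ} [hp : Fact (0 < p ∧ p < 1)]

theorem measurableSet_crossers (t : ℤ) (k : ℕ) (P : Set (ZMod (2 * n)) → Prop) :
    MeasurableSet {ω | P (crossers ω t k)} :=
  (determined_crossers t k P).measurableSet

/-- If any two entries (of different parities, in the Manhattan model) of the section that starts at
`t + k` are joined in it with probability at least `q`, then it lowers the expected number of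
crossings by at least `q` times the probability that some light crosses the section before it. -/
theorem mul_measureReal_crossers_nonempty_le {t : ℤ} {k k' : ℕ} {q : ℝ}
    (hq : ∀ r₁ r₂ : ZMod (2 * n), r₁ ≠ r₂ → (m = .manhattan → par r₂ = par r₁ + 1) →
      q ≤ (cfgLaw m p (ZMod (2 * n))).real {ω | Joins ω (strip (ZMod (2 * n)) (t + k) k')
        (entry (t + k) r₁) (rev (entry (t + k) r₂))}) :
    q * (cfgLaw m p (ZMod (2 * n))).real {ω | (crossers ω t k).Nonempty} ≤
      ∑ y : ZMod (2 * n), ((cfgLaw m p (ZMod (2 * n))).real {ω | y ∈ crossers ω t k} -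
        (cfgLaw m p (ZMod (2 * n))).real {ω | y ∈ crossers ω t (k + k')}) := by
  set μ := cfgLaw m p (ZMod (2 * n))
  let pair : ZMod (2 * n) → ZMod (2 * n) → ZMod (2 * n) → ZMod (2 * n) →
      Set (ℤ × ZMod (2 * n) → Site) := fun y₁ y₂ r₁ r₂ =>
    {ω | Joins ω (strip (ZMod (2 * n)) t k) (entry t y₁) (entry (t + k) r₁) ∧
      Joins ω (strip (ZMod (2 * n)) t k) (entry t y₂) (entry (t + k) r₂) ∧ r₁ ≠ r₂ ∧
      (m = .manhattan → par r₂ = par r₁ + 1)}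
  have hE : μ.real {ω | (crossers ω t k).Nonempty} ≤
      μ.real {ω | ∃ y₁ y₂ r₁ r₂, ω ∈ pair y₁ y₂ r₁ r₂} := by
    refine ENNReal.toReal_mono (measure_ne_top _ _) (measure_mono_ae ?_)
    filter_upwards [ae_allowed (p := p) (R := ZMod (2 * n)) m] with ω hω h
    exact exists_pair_of_crossers_nonempty hω h
  have hH : Determined {ω | ∃ y : ZMod (2 * n), y ∈ crossers ω t k ∧ y ∉ crossers ω t (k + k')}
      (strip (ZMod (2 * n)) t (k + k') : Set (ℤ × ZMod (2 * n))) := by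
    rintro ω ω' hω ⟨y, ⟨r, hr⟩, hy⟩
    refine ⟨y, ⟨r, hr.congr fun v hv => hω v (strip_subset_left _ _ _ hv)⟩, fun ⟨r', hr'⟩ => ?_⟩
    exact hy ⟨r', hr'.congr fun v hv => (hω v hv).symm⟩
  have hexp : q * μ.real {ω | ∃ y₁ y₂ r₁ r₂, ω ∈ pair y₁ y₂ r₁ r₂} ≤
      μ.real {ω | ∃ y : ZMod (2 * n), y ∈ crossers ω t k ∧ y ∉ crossers ω t (k + k')} := by
    refine mul_measureReal_le_of_exploration (fun v : ℤ × ZMod (2 * n) => law p m v)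
      (D := strip (ZMod (2 * n)) t k) (D' := strip (ZMod (2 * n)) t (k + k'))
      (A := fun _ => strip (ZMod (2 * n)) t k) (fun _ => subset_rfl) (fun _ _ _ => rfl) ?_
      hH.measurableSet ?_
    · rintro ω ω' hω ⟨y₁, y₂, r₁, r₂, h1, h2, h⟩
      exact ⟨y₁, y₂, r₁, r₂, h1.congr hω, h2.congr hω, h⟩
    · rintro ω ⟨y₁, y₂, r₁, r₂, h1, h2, hr, hpar⟩
      refine ⟨_, Determined.mono (determined_joins _ _ _) ?_, hq r₁ r₂ hr hpar, ?_⟩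
      · intro v hv
        refine ⟨strip_subset_right t k k' hv, fun hv' => ?_⟩
        rw [Finset.mem_coe, mem_strip] at hv hv'
        omega
      · intro ω' hω' hj
        have h1' := h1.congr hω'
        exact ⟨y₁, ⟨r₁, h1'⟩, notMem_crossers_of_joins h1' (h2.congr hω') hj⟩
  rcases le_or_gt q 0 with hq0 | hq0
  · refine (mul_nonpos_of_nonpos_of_nonneg hq0 measureReal_nonneg).trans
      (Finset.sum_nonneg fun y _ => sub_nonneg.mpr (measureReal_mono fun ω hω => ?_))
    exact crossers_subset ω t k k' hω
  refine (mul_le_mul_of_nonneg_left hE hq0.le).trans (hexp.trans ?_)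
  have hsub : {ω | ∃ y : ZMod (2 * n), y ∈ crossers ω t k ∧ y ∉ crossers ω t (k + k')} ⊆
      ⋃ y ∈ (Finset.univ : Finset (ZMod (2 * n))),
        ({ω | y ∈ crossers ω t k} \ {ω | y ∈ crossers ω t (k + k')}) := by
    rintro ω ⟨y, h⟩
    simp only [Set.mem_iUnion]
    exact ⟨y, Finset.mem_univ y, h⟩
  refine (measureReal_mono hsub (measure_ne_top _ _)).trans
    ((measureReal_biUnion_finset_le _ _).trans (le_of_eq (Finset.sum_congr rfl fun y _ => ?_)))
  exact measureReal_sdiff (fun ω hω => crossers_subset ω t k k' hω)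
    (measurableSet_crossers t (k + k') fun s => y ∈ s)

/-- As there are at most `2 * n` crossings, the probability that some light crosses `J` consecutive
sections is at most of order `n / (q * J)`. -/
theorem mul_measureReal_crossers_iterate_le {q : ℝ}
    (hq : ∀ t : ℤ, (m = .manhattan → Even t) → ∀ r₁ r₂ : ZMod (2 * n), r₁ ≠ r₂ →
      (m = .manhattan → par r₂ = par r₁ + 1) →
      q ≤ (cfgLaw m p (ZMod (2 * n))).real {ω | Joins ω (strip (ZMod (2 * n)) t (2 * n))
        (entry t r₁) (rev (entry t r₂))}) (hq0 : 0 ≤ q) {t : ℤ} (ht : m = .manhattan → Even t)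
    (J : ℕ) :
    q * J * (cfgLaw m p (ZMod (2 * n))).real
      {ω | (crossers (R := ZMod (2 * n)) ω t (2 * n * J)).Nonempty} ≤ 2 * n := by
  set μ := cfgLaw m p (ZMod (2 * n))
  have hmono : ∀ j ≤ J, μ.real {ω | (crossers (R := ZMod (2 * n)) ω t (2 * n * J)).Nonempty} ≤
      μ.real {ω | (crossers (R := ZMod (2 * n)) ω t (2 * n * j)).Nonempty} := by
    intro j hj
    obtain ⟨i, rfl⟩ := Nat.exists_eq_add_of_le hj
    refine measureReal_mono fun ω hω => ?_
    rw [Set.mem_ofPred_eq, mul_add] at hω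
    exact hω.mono (crossers_subset ω t _ _)
  let a : ℕ → ℝ := fun j => ∑ y : ZMod (2 * n), μ.real {ω | y ∈ crossers ω t (2 * n * j)}
  have hdrop : ∀ j, q * μ.real {ω | (crossers (R := ZMod (2 * n)) ω t (2 * n * j)).Nonempty} ≤
      a j - a (j + 1) := by
    intro j
    have h := mul_measureReal_crossers_nonempty_le (m := m) (p := p) (t := t) (k := 2 * n * j)
      (k' := 2 * n) (q := q) (hq _ fun hm => by
        have h1 := ht hm
        rw [Int.even_add]
        simp [h1])
    rw [Finset.sum_sub_distrib] at h
    exact h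
  calc q * J * μ.real {ω | (crossers (R := ZMod (2 * n)) ω t (2 * n * J)).Nonempty}
      = ∑ j ∈ Finset.range J,
          q * μ.real {ω | (crossers (R := ZMod (2 * n)) ω t (2 * n * J)).Nonempty} := by
        rw [Finset.sum_const, Finset.card_range, nsmul_eq_mul]
        ring
    _ ≤ ∑ j ∈ Finset.range J, (a j - a (j + 1)) := Finset.sum_le_sum fun j hj =>
        (mul_le_mul_of_nonneg_left (hmono j (Finset.mem_range.mp hj).le) hq0).trans (hdrop j)
    _ = a 0 - a J := Finset.sum_range_sub' a J
    _ ≤ a 0 := sub_le_self _ (Finset.sum_nonneg fun _ _ => measureReal_nonneg)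
    _ ≤ ∑ _y : ZMod (2 * n), 1 := Finset.sum_le_sum fun y _ => measureReal_le_one
    _ = 2 * n := by
        rw [Finset.sum_const, Finset.card_univ, ZMod.card, nsmul_one]
        push_cast
        ring

/-- The sections of a certain length of order at most `n ^ 9` are crossed by some light with
probability at most `1 / 2`. -/
theorem exists_length_crossers_le (m : Model) (n : ℕ) [NeZero (2 * n)] :
    ∃ B : ℕ, 0 < B ∧ Even B ∧ (B : ℝ) ≤ 2 * (995328 / minProb p ^ 2 + 1) * (n : ℝ) ^ 9 ∧
      ∀ t : ℤ, (m = .manhattan → Even t) → (cfgLaw m p (ZMod (2 * n))).real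
        {ω | (crossers (R := ZMod (2 * n)) ω t B).Nonempty} ≤ 1 / 2 := by
  have hc : 0 < minProb p := minProb_pos
  have hn : 0 < n := by
    have := NeZero.ne (2 * n)
    omega
  have hn1 : (1 : ℝ) ≤ n := by exact_mod_cast hn
  have hn0 : (0 : ℝ) < n := by linarith
  have hpow : ∀ k l : ℕ, k ≤ l → (n : ℝ) ^ k ≤ (n : ℝ) ^ l := fun k l h =>
    pow_le_pow_right₀ hn1 h
  by_cases hcase : ∃ t₀ : ℤ, (m = .manhattan → Even t₀) ∧ ∃ y₀ : ZMod (2 * n),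
      1 / (4 * (n : ℝ)) ≤ (cfgLaw m p (ZMod (2 * n))).real {ω | y₀ ∈ crossers ω t₀ (2 * n)}
  · obtain ⟨t₀, ht₀, y₀, hy₀⟩ := hcase
    set q : ℝ := minProb p ^ 2 / (248832 * (n : ℝ) ^ 7) with hqdef
    have hq0 : 0 < q := by positivity
    have hq := fun (t : ℤ) (ht : m = .manhattan → Even t) (r₁ r₂ : ZMod (2 * n)) (hr : r₁ ≠ r₂)
        (hpar : m = .manhattan → par r₂ = par r₁ + 1) => by
      have h := le_measureReal_joins_strip (m := m) (p := p) (n := n) (b := 1 / (12 * n))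
        (by positivity) ht₀ (y₀ := y₀) (le_trans (le_of_eq (by field_simp; norm_num)) hy₀)
        ht hr hpar
      have h' : q ≤ (cfgLaw m p (ZMod (2 * n))).real {ω | Joins ω
          (strip (ZMod (2 * n)) t (2 * n)) (entry t r₁) (rev (entry t r₂))} := by
        refine le_of_mul_le_mul_left (le_trans (le_of_eq ?_) h)
          (by positivity : (0 : ℝ) < 9 * (2 * n) ^ 4)
        rw [hqdef]
        field_simp
        norm_num
      exact h'
    obtain ⟨J, hJ⟩ : ∃ J : ℕ, J = ⌈4 * n / q⌉₊ := ⟨_, rfl⟩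
    have hJ1 : 4 * n / q ≤ J := hJ ▸ Nat.le_ceil _
    have hJ2 : (J : ℝ) ≤ 4 * n / q + 1 := hJ ▸ (Nat.ceil_lt_add_one (by positivity)).le
    have hJ0 : (0 : ℝ) < J := lt_of_lt_of_le (by positivity) hJ1
    refine ⟨2 * n * J, ?_, ?_, ?_, ?_⟩
    · have : 0 < J := by exact_mod_cast hJ0
      positivity
    · rw [mul_assoc]
      exact even_two_mul _
    · have h4 : 4 * n / q = 995328 / minProb p ^ 2 * (n : ℝ) ^ 8 := by
        rw [hqdef]
        field_simp
        norm_num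
      have h8 := hpow 0 8 (by omega)
      push_cast
      calc 2 * (n : ℝ) * J ≤ 2 * n * (995328 / minProb p ^ 2 * (n : ℝ) ^ 8 + (n : ℝ) ^ 8) := by
            refine mul_le_mul_of_nonneg_left ?_ (by positivity)
            rw [pow_zero] at h8
            linarith
        _ = _ := by ring
    · intro t ht
      have h := mul_measureReal_crossers_iterate_le hq hq0.le ht J
      have h4 : 4 * n ≤ q * J := by
        rw [div_le_iff₀ hq0] at hJ1
        linarith
      set x := (cfgLaw m p (ZMod (2 * n))).real
        {ω | (crossers (R := ZMod (2 * n)) ω t (2 * n * J)).Nonempty}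
      have hx : 0 ≤ x := measureReal_nonneg
      have h5 : 4 * n * x ≤ 2 * n := (mul_le_mul_of_nonneg_right h4 hx).trans h
      have h6 : (2 * n : ℝ) * (2 * x) ≤ 2 * n * 1 := by linarith
      have := le_of_mul_le_mul_left h6 (by positivity)
      linarith
  · push Not at hcase
    refine ⟨2 * n, by positivity, even_two_mul n, ?_, fun t ht => ?_⟩
    · have h9 := hpow 1 9 (by omega)
      have h1 : 0 ≤ 995328 / minProb p ^ 2 := by positivity
      push_cast
      rw [pow_one] at h9
      nlinarith [mul_nonneg h1 (pow_nonneg hn0.le 9)]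
    · have hsub : {ω | (crossers (R := ZMod (2 * n)) ω t (2 * n)).Nonempty} ⊆
          ⋃ y ∈ (Finset.univ : Finset (ZMod (2 * n))), {ω | y ∈ crossers ω t (2 * n)} := by
        rintro ω ⟨y, h⟩
        simp only [Set.mem_iUnion]
        exact ⟨y, Finset.mem_univ y, h⟩
      refine (measureReal_mono hsub (measure_ne_top _ _)).trans
        ((measureReal_biUnion_finset_le _ _).trans ?_)
      refine (Finset.sum_le_sum fun y _ => (hcase t ht y).le).trans (le_of_eq ?_)
      rw [Finset.sum_const, Finset.card_univ, ZMod.card, nsmul_eq_mul]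
      push_cast
      field_simp
      norm_num

theorem measureReal_forall_crossers_nonempty_le {B : ℕ} (hBe : Even B)
    (hB : ∀ t : ℤ, (m = .manhattan → Even t) → (cfgLaw m p (ZMod (2 * n))).real
      {ω | (crossers (R := ZMod (2 * n)) ω t B).Nonempty} ≤ 1 / 2) {t : ℤ}
    (ht : m = .manhattan → Even t) (K : ℕ) :
    (cfgLaw m p (ZMod (2 * n))).real
      {ω | ∀ i < K, (crossers (R := ZMod (2 * n)) ω (t + B * i) B).Nonempty} ≤ (1 / 2) ^ K := by
  induction K with
  | zero => rw [pow_zero]; exact measureReal_le_one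
  | succ K ih =>
    have h1 : Determined
        {ω | ∀ i < K, (crossers (R := ZMod (2 * n)) ω (t + B * i) B).Nonempty}
        (strip (ZMod (2 * n)) t (B * K) : Set (ℤ × ZMod (2 * n))) := by
      intro ω ω' hω h i hi
      refine determined_crossers _ _ (fun s => s.Nonempty) ω ω' (fun v hv => hω v ?_) (h i hi)
      rw [Finset.mem_coe, mem_strip] at hv ⊢
      have h2 : (B : ℤ) * (i + 1) ≤ B * K := by
        have : ((i + 1 : ℕ) : ℤ) ≤ K := by exact_mod_cast hi
        push_cast at this
        exact mul_le_mul_of_nonneg_left this (by positivity)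
      have h3 : (0 : ℤ) ≤ B * i := by positivity
      rw [mul_add, mul_one] at h2
      push_cast
      omega
    have h2 := determined_crossers (R := ZMod (2 * n)) (t + B * K) B fun s => s.Nonempty
    have hdisj : Disjoint (strip (ZMod (2 * n)) t (B * K))
        (strip (ZMod (2 * n)) (t + B * K) B) := by
      rw [Finset.disjoint_left]
      intro v hv hv'
      rw [mem_strip] at hv hv'
      push_cast at hv
      omega
    have h3 := measureReal_inter_of_determined (fun v : ℤ × ZMod (2 * n) => law p m v) h1 h2 hdisj
    have hset : {ω | ∀ i < K + 1, (crossers (R := ZMod (2 * n)) ω (t + B * i) B).Nonempty} =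
        {ω | ∀ i < K, (crossers (R := ZMod (2 * n)) ω (t + B * i) B).Nonempty} ∩
          {ω | (crossers (R := ZMod (2 * n)) ω (t + B * K) B).Nonempty} := by
      ext ω
      constructor
      · exact fun h => ⟨fun i hi => h i (by omega), h K (by omega)⟩
      · rintro ⟨h, h'⟩ i hi
        rcases Nat.lt_succ_iff_lt_or_eq.mp hi with hi | rfl
        · exact h i hi
        · exact h'
    rw [hset, pow_succ]
    refine (le_of_eq h3).trans
      (mul_le_mul ih (hB _ fun hm => ?_) measureReal_nonneg (by positivity))
    have h4 := ht hm
    have h5 : Even (B : ℤ) := by exact_mod_cast hBe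
    exact h4.add (h5.mul_right _)

/-- If both the `K` sections of length `B` to the right of the column `0` and the `K` sections to
the left of it contain a section without crossings, then light is trapped. -/
theorem one_sub_le_localizationEvent {B : ℕ} (hB0 : 0 < B) (hBe : Even B)
    (hB : ∀ t : ℤ, (m = .manhattan → Even t) → (cfgLaw m p (ZMod (2 * n))).real
      {ω | (crossers (R := ZMod (2 * n)) ω t B).Nonempty} ≤ 1 / 2) {K M : ℕ}
    (hM : (K + 1) * B ≤ M) :
    1 - 2 * (1 / 2) ^ K ≤ (cfgLaw m p (ZMod (2 * n))).real (localizationEvent n M) := by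
  set μ := cfgLaw m p (ZMod (2 * n))
  have hBe' : Even (B : ℤ) := by exact_mod_cast hBe
  have hright := measureReal_forall_crossers_nonempty_le (m := m) (p := p) hBe hB (t := 0)
    (fun _ => by simp) K
  have hleft := measureReal_forall_crossers_nonempty_le (m := m) (p := p) hBe hB
    (t := -((K + 1) * B)) (fun _ => (hBe'.mul_left _).neg) K
  have hsub : (localizationEvent n M)ᶜ ⊆
      {ω | ∀ i < K, (crossers (R := ZMod (2 * n)) ω (0 + B * i) B).Nonempty} ∪
      {ω | ∀ i < K, (crossers (R := ZMod (2 * n)) ω (-((K + 1) * B) + B * i) B).Nonempty} := by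
    intro ω hω
    by_contra hcon
    rw [Set.mem_union, not_or] at hcon
    simp only [Set.mem_ofPred_eq, not_forall, Set.not_nonempty_iff_eq_empty] at hcon
    obtain ⟨⟨i, hi, h⟩, j, hj, h'⟩ := hcon
    have hM' : ((K : ℤ) + 1) * B ≤ M := by exact_mod_cast hM
    have hbound : ∀ i : ℕ, i < K → (B : ℤ) * i + B ≤ K * B := by
      intro i hi
      have h1 : ((i + 1 : ℕ) : ℤ) ≤ K := by exact_mod_cast hi
      have h2 : (B : ℤ) * ((i + 1 : ℕ) : ℤ) ≤ B * K :=
        mul_le_mul_of_nonneg_left h1 (by positivity)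
      push_cast at h2
      linarith
    have hi' := hbound i hi
    have hj' := hbound j hj
    have h0 : (0 : ℤ) ≤ B * i := by positivity
    have h0' : (0 : ℤ) ≤ B * j := by positivity
    have hB0' : (0 : ℤ) < B := by exact_mod_cast hB0
    exact hω (mem_localizationEvent h (by linarith) (by linarith) h' (by linarith) (by linarith))
  have h1 := (measureReal_mono (μ := μ) hsub (measure_ne_top _ _)).trans (measureReal_union_le _ _)
  rw [probReal_compl_eq_one_sub (measurableSet_localizationEvent n M)] at h1
  linarith

end Decay

end MirrorModel

end

theorem theorem1p1 (m : MirrorModel.Model) (p : ℝ) (hp0 : 0 < p) (hp1 : p < 1) :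
    ∃ C₀ : ℝ, 0 < C₀ ∧ ∀ n M : ℕ, C₀ < (n : ℝ) → C₀ * (n : ℝ) ^ 10 < (M : ℝ) →
      1 - C₀ * Real.exp (-((M : ℝ) / (C₀ * (n : ℝ) ^ 10))) ≤
        (MirrorModel.configLaw m n p).real (MirrorModel.localizationEvent n M) := by
  have hp : Fact (0 < p ∧ p < 1) := ⟨hp0, hp1⟩
  have hc : 0 < MirrorModel.minProb p := MirrorModel.minProb_pos
  set C : ℝ := 2 * (995328 / MirrorModel.minProb p ^ 2 + 1) with hC
  have hC0 : 0 < C := by positivity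
  refine ⟨2 * C + 8, by positivity, fun n M hn hM => ?_⟩
  have hn0 : 0 < n := by
    have : (0 : ℝ) < n := lt_trans (by positivity) hn
    exact_mod_cast this
  have hn1 : (1 : ℝ) ≤ n := by exact_mod_cast hn0
  have : NeZero (2 * n) := ⟨by omega⟩
  obtain ⟨B, hB0, hBe, hBn, hB⟩ := MirrorModel.exists_length_crossers_le (p := p) m n
  rw [← hC] at hBn
  rw [MirrorModel.configLaw_eq]
  have hB0' : (0 : ℝ) < B := by exact_mod_cast hB0
  have hn910 : (n : ℝ) ^ 9 ≤ (n : ℝ) ^ 10 := pow_le_pow_right₀ hn1 (by omega)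
  have h2B : 2 * (B : ℝ) ≤ (2 * C + 8) * (n : ℝ) ^ 10 := by
    have h1 : C * (n : ℝ) ^ 9 ≤ C * (n : ℝ) ^ 10 := mul_le_mul_of_nonneg_left hn910 hC0.le
    have h2 : (0 : ℝ) ≤ 8 * (n : ℝ) ^ 10 := by positivity
    linarith
  have hBM : B ≤ M := by
    have : (B : ℝ) ≤ M := by linarith
    exact_mod_cast this
  -- `K + 1` sections of length `B` fit into `{1, …, M}`, but `K + 2` do not
  obtain ⟨K, hK⟩ : ∃ K, M / B = K + 1 := Nat.exists_eq_succ_of_ne_zero (Nat.div_pos hBM hB0).ne'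
  have hK1 : (K + 1) * B ≤ M := hK ▸ Nat.div_mul_le_self M B
  have hK2 : M < (K + 2) * B := by
    have := Nat.lt_div_mul_add (a := M) hB0
    rw [hK] at this
    linarith
  have hK2' : (M : ℝ) ≤ (K + 2) * B := by exact_mod_cast hK2.le
  refine le_trans ?_ (MirrorModel.one_sub_le_localizationEvent hB0 hBe hB hK1)
  have hhalf : (1 / 2 : ℝ) ≤ Real.exp (-(1 / 2)) := by
    have := Real.add_one_le_exp (-(1 / 2) : ℝ)
    linarith
  have hexp : (1 / 2 : ℝ) ^ (K + 2) ≤ Real.exp (-((M : ℝ) / ((2 * C + 8) * (n : ℝ) ^ 10))) := by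
    calc (1 / 2 : ℝ) ^ (K + 2) ≤ Real.exp (-(1 / 2)) ^ (K + 2) :=
          pow_le_pow_left₀ (by norm_num) hhalf _
      _ = Real.exp (-((K + 2 : ℝ) / 2)) := by
          rw [← Real.exp_nat_mul]
          congr 1
          push_cast
          ring
      _ ≤ _ := by
          refine Real.exp_le_exp.mpr (neg_le_neg ?_)
          rw [div_le_div_iff₀ (by positivity) (by norm_num)]
          have h1 : (K + 2 : ℝ) * (2 * B) ≤ (K + 2) * ((2 * C + 8) * (n : ℝ) ^ 10) :=
            mul_le_mul_of_nonneg_left h2B (by positivity)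
          linarith
  have hpos := Real.exp_pos (-((M : ℝ) / ((2 * C + 8) * (n : ℝ) ^ 10)))
  rw [pow_add] at hexp
  have h8 : 8 * Real.exp (-((M : ℝ) / ((2 * C + 8) * (n : ℝ) ^ 10))) ≤
      (2 * C + 8) * Real.exp (-((M : ℝ) / ((2 * C + 8) * (n : ℝ) ^ 10))) :=
    mul_le_mul_of_nonneg_right (by linarith) hpos.le
  linarith
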